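/- All lattices are finite. An element $a$ of a lattice is \emph{reducible} if $a=b\wedge c$ (meet-reducible) or $a=b\vee c$ (join-reducible) for some $b,c\neq a$. A \emph{block} is a lattice whose largest element is join-reducible and whose smallest element is meet-reducible. The \emph{nullity} of a poset is $p-q+c$, where $p,q,c$ are the numbers of edges, vertices and connected components of its cover graph. In a finite poset $P$, let $\mathrm{Irr}(P)$ be the set of elements with at most one upper and at most one lower cover, $\mathrm{Irr}^*(P)$ the set of those with exactly one of each, and $\mathrm{Red}(P)=P\setminus\mathrm{Irr}(P)$. An element $x\in\mathrm{Irr}(P)$ is \emph{retractible} if either there are no $y,z\in\mathrm{Red}(P)$ with $y\prec x\prec z$, or there are such $y,z$ and $y\prec x\prec z$ is the only directed path (sequence of successive coverings) from $y$ to $z$. The \emph{basic block associated to} $P$ is obtained (up to isomorphism) from $P$ by successively removing retractible elements of $\mathrm{Irr}^*$ until none is left, and then successively removing all pendant vertices of the cover graph. Let $\mathscr{B}(j;4,3)$ be the class of isomorphism classes of blocks on $j$ elements having exactly four reducible elements, these being pairwise comparable, and nullity three; let $\mathscr{B}(j;4,3,3)$ be the subclass of those whose associated basic block has height $3$ (the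 height being the number of coverings in a longest chain). Let $C:0\prec a\prec b\prec 1$ be a $4$-chain, and let $B_1,B_2,B_3$ be the $7$-element lattices obtained from $C$ by adding three elements $c_1,c_2,c_3$, each $c_i$ being placed between the two members of a pair $(u_i,v_i)$ of elements of $C$ as a new element with unique lower cover $u_i$ and unique upper cover $v_i$, where the three pairs are $(a,1),(0,b),(0,b)$ for $B_1$; $(0,b),(a,1),(a,1)$ for $B_2$ (the dual of $B_1$); and $(0,b),(a,1),(0,1)$ for $B_3$. Let $\mathbb{B}_i(j;4,3)$ be the subclass of $\mathscr{B}(j;4,3)$ of those blocks whose associated basic block is isomorphic to $B_i$. Let $P_n^k$ be the number of partitions of $n$ into exactly $k$ positive parts. Theorem. For every integer $j\ge 7$, $$|\mathscr{B}(j;4,3,3)|=\sum_{i=1}^{3}|\mathbb{B}_i(j;4,3)|=\sum_{s=1}^{j-6}\;\sum_{r=1}^{j-s-5}\;\sum_{l=2}^{j-s-r-3}2\,(j-s-r-l-2)\,P_l^2\;+\;\sum_{p=1}^{j-6}\binom{j-p-2}{4}.$$ -/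

import Mathlib

namespace RCLattice

section Posets

variable {P : Type*} [PartialOrder P]

/-- `x` is doubly irreducible in the poset `P`: at most one lower cover and at most one
upper cover. -/
def Irr (x : P) : Prop :=
  {y : P | y ⋖ x}.Subsingleton ∧ {z : P | x ⋖ z}.Subsingleton

/-- `x` has exactly one lower cover and exactly one upper cover in `P`. -/
def IrrStar (x : P) : Prop :=
  (∃! y : P, y ⋖ x) ∧ (∃! z : P, x ⋖ z)

/-- `x` is a retractible element of `P`: it is doubly irreducible and either it does not lie
immediately between two elements that are not doubly irreducible, or it does, say between `y`
and `z`, and `y ⋖ x ⋖ z` is the only directed path (sequence of successive coverings) from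
`y` to `z`. -/
def Retractible (x : P) : Prop :=
  Irr x ∧
    ((¬ ∃ y z : P, ¬ Irr y ∧ ¬ Irr z ∧ y ⋖ x ∧ x ⋖ z) ∨
      (∃ y z : P, ¬ Irr y ∧ ¬ Irr z ∧ y ⋖ x ∧ x ⋖ z ∧
        ∀ l : List P, l.IsChain (· ⋖ ·) → l.head? = some y → l.getLast? = some z →
          l = [y, x, z]))

/-- `x` is a pendant vertex (a vertex of degree one) of the cover graph of `P`. -/
def Pendant (x : P) : Prop :=
  ((SimpleGraph.hasse P).neighborSet x).ncard = 1

/-- Passing from the subposet `S` to the subposet `T` by removing one retractible element of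
`Irr*(S)`. -/
def RetractStep (S T : Set P) : Prop :=
  ∃ x : S, IrrStar x ∧ Retractible x ∧ T = S \ {(x : P)}

/-- Passing from the subposet `S` to the subposet `T` by removing one pendant vertex of `S`. -/
def PendantStep (S T : Set P) : Prop :=
  ∃ x : S, Pendant x ∧ T = S \ {(x : P)}

/-- `R` is a basic retract associated to `P`: it is obtained from `P` by successive removal of
retractible elements of `Irr*`, until none is left. -/
def IsBasicRetractOf (R : Set P) : Prop :=
  Relation.ReflTransGen RetractStep Set.univ R ∧ ∀ x : R, IrrStar x → ¬ Retractible x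

/-- `B` is a basic block associated to `P`: it is obtained from a basic retract associated to
`P` by successive removal of all the pendant vertices. -/
def IsBasicBlockOf (B : Set P) : Prop :=
  ∃ R : Set P, IsBasicRetractOf R ∧ Relation.ReflTransGen PendantStep R B ∧
    ∀ x : B, ¬ Pendant x

variable (P) in
/-- The nullity of the cover graph of `P`: edges minus vertices plus connected components. -/
noncomputable def nullity : ℤ :=
  ((SimpleGraph.hasse P).edgeSet.ncard : ℤ) - (Nat.card P : ℤ)
    + (Nat.card (SimpleGraph.hasse P).ConnectedComponent : ℤ)

end Posets

section Lattices

variable {L : Type*} [Lattice L]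

def MeetReducible (a : L) : Prop := ∃ b c : L, b ≠ a ∧ c ≠ a ∧ b ⊓ c = a

def JoinReducible (a : L) : Prop := ∃ b c : L, b ≠ a ∧ c ≠ a ∧ b ⊔ c = a

def Reducible (a : L) : Prop := MeetReducible a ∨ JoinReducible a

variable (L) in
/-- A block: the largest element is join-reducible and the smallest is meet-reducible. -/
def IsBlock : Prop :=
  (∃ t : L, IsTop t ∧ JoinReducible t) ∧ (∃ b : L, IsBot b ∧ MeetReducible b)

variable (L) in
/-- `L` is a block with exactly `r` reducible elements, these being pairwise comparable, and
with nullity `k`. -/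
def IsRCBlock (r k : ℕ) : Prop :=
  IsBlock L ∧ {a : L | Reducible a}.ncard = r ∧ IsChain (· ≤ ·) {a : L | Reducible a} ∧
    nullity L = k

variable (L) in
/-- The basic block associated to `L` has height (length of a longest chain) `h`. -/
def HasBasicBlockHeight (h : ℕ) : Prop :=
  ∃ S : Set L, IsBasicBlockOf S ∧ Order.krullDim S = (h : WithBot ℕ∞)

variable (L) in
/-- The basic block associated to `L` is isomorphic to `B`. -/
def HasBasicBlock (B : Type) [PartialOrder B] : Prop :=
  ∃ S : Set L, IsBasicBlockOf S ∧ Nonempty (S ≃o B)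

end Lattices

/-- Isomorphism of lattice structures on `Fin n`. -/
def latticeIso (n : ℕ) : Setoid (Lattice (Fin n)) where
  r L M := Nonempty (@OrderIso (Fin n) (Fin n) L.toLE M.toLE)
  iseqv :=
    ⟨fun L => ⟨@OrderIso.refl (Fin n) L.toLE⟩,
      fun {L M} ⟨e⟩ => ⟨@OrderIso.symm (Fin n) (Fin n) L.toLE M.toLE e⟩,
      fun {L M N} ⟨e⟩ ⟨f⟩ =>
        ⟨@OrderIso.trans (Fin n) (Fin n) (Fin n) L.toLE M.toLE N.toLE e f⟩⟩

/-- The isomorphism classes of lattices on `n` elements. -/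
def LatticeClass (n : ℕ) : Type := Quotient (latticeIso n)

/-- The isomorphism class of a lattice structure on `Fin n`. -/
def classOf {n : ℕ} (L : Lattice (Fin n)) : LatticeClass n := Quotient.mk (latticeIso n) L

/-- `𝓑(j; r, k, h)`: isomorphism classes of blocks on `j` elements with exactly `r` reducible
elements, all comparable, with nullity `k`, whose associated basic block has height `h`. -/
def blockClass (j r k h : ℕ) : Set (LatticeClass j) :=
  classOf '' {L : Lattice (Fin j) | @IsRCBlock (Fin j) L r k ∧ @HasBasicBlockHeight (Fin j) L h}

/-- Isomorphism classes of blocks on `j` elements with exactly `r` reducible elements, all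
comparable, with nullity `k`, whose associated basic block is isomorphic to `B`. -/
def blockClassOfType (j r k : ℕ) (B : Type) [PartialOrder B] : Set (LatticeClass j) :=
  classOf '' {L : Lattice (Fin j) | @IsRCBlock (Fin j) L r k ∧ @HasBasicBlock (Fin j) L B _}

/-- The underlying set of the iterated adjunct of the `4`-chain `0 < 1 < 2 < 3` with three
one-element chains `c₀, c₁, c₂`, where `c` is attached at the adjunct pair `p c`. -/
inductive ChainAdjunct (p : Fin 3 → {q : Fin 4 × Fin 4 // q.1 < q.2}) : Type
  | chain (x : Fin 4)
  | pt (c : Fin 3)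

/-- The order of the iterated adjunct: `x ≤ c` iff `x` is below the lower member of the pair
of `c`, and `c ≤ y` iff `y` is above the upper member. -/
def ChainAdjunct.le {p : Fin 3 → {q : Fin 4 × Fin 4 // q.1 < q.2}} :
    ChainAdjunct p → ChainAdjunct p → Prop
  | .chain x, .chain y => x ≤ y
  | .chain x, .pt c => x ≤ (p c).1.1
  | .pt c, .chain y => (p c).1.2 ≤ y
  | .pt c, .pt d => c = d ∨ (p c).1.2 ≤ (p d).1.1

instance (p : Fin 3 → {q : Fin 4 × Fin 4 // q.1 < q.2}) : PartialOrder (ChainAdjunct p) where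
  le := ChainAdjunct.le
  le_refl x := by cases x <;> simp [ChainAdjunct.le]
  le_trans x y z hxy hyz := by
    rcases x with x | x <;> rcases y with y | y <;> rcases z with z | z <;>
      simp only [ChainAdjunct.le] at hxy hyz ⊢ <;> grind
  le_antisymm x y hxy hyx := by
    rcases x with x | x <;> rcases y with y | y <;> simp only [ChainAdjunct.le] at hxy hyx
    · rw [le_antisymm hxy hyx]
    · have h := (p y).2; grind
    · have h := (p x).2; grind
    · have h := (p x).2; have h1 := (p y).2; grind

/-- The adjunct pairs of the three basic blocks. With `0 < a < b < 1` the elements of the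
`4`-chain: `(a,1), (0,b), (0,b)` for the first, `(0,b), (a,1), (a,1)` for the second (the dual of
the first) and `(0,b), (a,1), (0,1)` for the third. -/
def basicPairs : Fin 3 → Fin 3 → {q : Fin 4 × Fin 4 // q.1 < q.2} :=
  ![![⟨(1, 3), by decide⟩, ⟨(0, 2), by decide⟩, ⟨(0, 2), by decide⟩],
    ![⟨(0, 2), by decide⟩, ⟨(1, 3), by decide⟩, ⟨(1, 3), by decide⟩],
    ![⟨(0, 2), by decide⟩, ⟨(1, 3), by decide⟩, ⟨(0, 3), by decide⟩]]

/-- The basic blocks `B₁, B₂, B₃` (indexed from `0`). -/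
abbrev BasicB (i : Fin 3) : Type := ChainAdjunct (basicPairs i)

/-- The number of partitions of `n` into exactly `k` positive parts. -/
def partitionCount (n k : ℕ) : ℕ :=
  (Finset.univ.filter fun q : n.Partition => q.parts.card = k).card

end RCLattice

/-! ### Frames and nets -/

namespace RCLattice

/-! Let `L` be a block whose reducible elements form a chain of four. In a finite lattice an element
is reducible exactly when it has two upper or two lower covers, so every other element lies on a
path of doubly irreducible elements joining two members of the chain. Thus `L` is a multigraph on
four nodes whose edges are subdivided. The edges correspond to the coverings that start at a node
(`exists_rep_of_chain`, `Rep.card_coverings`). Every element that is not a node has exactly one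
upper cover, so the nullity is the number of edges minus 4 plus 1, and nullity three means six
edges. Three of these join consecutive nodes; the other three are the adjunct pairs.

A `Rep` records this structure as an embedding into a net. Only the order of the positions on an
edge matters, so subposets are represented by restricting the embedding. Call an edge essential if
another edge runs within its interval. Retraction never removes the last element of an essential
edge, and it does not stop before each essential edge carries one element and every other edge none.
No pendant vertices ever arise. Height three therefore forces each extra pair to be one of (0,2),
(1,3), (0,3). Node 2 is reducible only if (0,2) occurs, and node 1 only if (1,3) occurs. The third
pair is free, which gives exactly `B₁`, `B₂`, `B₃`.

An isomorphism fixes the nodes and matches edges with the same ends. A class is therefore given by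
the type and the six edge sizes, up to exchanging the two parallel edges of `B₁` or `B₂`
(`exists_parametrization`). The chain edges may be empty, the extra edges may not, and the sizes add
up to `j - 4`. Counting these size vectors gives the formula. -/

/-- A multigraph on the chain `0 < 1 < 2 < 3` whose edges all point upwards. -/
structure Frame (E : Type*) where
  lo : E → Fin 4
  hi : E → Fin 4
  lt : ∀ e, lo e < hi e

/-- The poset obtained from the chain `0 < 1 < 2 < 3` by placing, for every edge `e` of the frame,
a copy of `ℕ` between the ends of `e`. -/
inductive Net {E : Type*} (F : Frame E) : Type _
  | node (k : Fin 4)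
  | pt (e : E) (i : ℕ)

namespace Net

variable {E : Type*} {F : Frame E}

def le : Net F → Net F → Prop
  | .node x, .node y => x ≤ y
  | .node x, .pt e _ => x ≤ F.lo e
  | .pt e _, .node y => F.hi e ≤ y
  | .pt e i, .pt d k => (e = d ∧ i ≤ k) ∨ F.hi e ≤ F.lo d

instance : PartialOrder (Net F) where
  le := le
  le_refl x := by cases x <;> simp [le]
  le_trans x y z hxy hyz := by
    rcases x with x | ⟨x, i⟩ <;> rcases y with y | ⟨y, k⟩ <;> rcases z with z | ⟨z, l⟩ <;>
      simp only [le] at hxy hyz ⊢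
    · exact hxy.trans hyz
    · exact hxy.trans hyz
    · exact hxy.trans ((F.lt y).le.trans hyz)
    · rcases hyz with ⟨rfl, -⟩ | h
      · exact hxy
      · exact hxy.trans ((F.lt y).le.trans h)
    · exact hxy.trans hyz
    · exact Or.inr (hxy.trans hyz)
    · rcases hxy with ⟨rfl, -⟩ | h
      · exact hyz
      · exact h.trans ((F.lt y).le.trans hyz)
    · rcases hxy with ⟨rfl, h⟩ | h <;> rcases hyz with ⟨rfl, h'⟩ | h'
      · exact Or.inl ⟨rfl, h.trans h'⟩
      · exact Or.inr h'
      · exact Or.inr h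
      · exact Or.inr (h.trans ((F.lt y).le.trans h'))
  le_antisymm x y hxy hyx := by
    rcases x with x | ⟨x, i⟩ <;> rcases y with y | ⟨y, k⟩ <;> simp only [le] at hxy hyx
    · rw [le_antisymm hxy hyx]
    · exact absurd (hyx.trans hxy) (F.lt y).not_ge
    · exact absurd (hxy.trans hyx) (F.lt x).not_ge
    · rcases hxy with ⟨rfl, h⟩ | h <;> rcases hyx with ⟨h', h''⟩ | h'
      · rw [le_antisymm h h'']
      · exact absurd h' (F.lt x).not_ge
      · subst h'
        exact absurd h (F.lt _).not_ge
      · exact absurd (h.trans ((F.lt y).le.trans h')) (F.lt x).not_ge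

@[simp] theorem node_le_node {x y : Fin 4} : (node x : Net F) ≤ node y ↔ x ≤ y := Iff.rfl

@[simp] theorem node_le_pt {x : Fin 4} {e : E} {i : ℕ} : (node x : Net F) ≤ pt e i ↔ x ≤ F.lo e :=
  Iff.rfl

@[simp] theorem pt_le_node {y : Fin 4} {e : E} {i : ℕ} : (pt e i : Net F) ≤ node y ↔ F.hi e ≤ y :=
  Iff.rfl

@[simp] theorem pt_le_pt {e d : E} {i k : ℕ} :
    (pt e i : Net F) ≤ pt d k ↔ (e = d ∧ i ≤ k) ∨ F.hi e ≤ F.lo d := Iff.rfl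

@[simp] theorem node_lt_node {x y : Fin 4} : (node x : Net F) < node y ↔ x < y := by
  rw [lt_iff_le_not_ge, lt_iff_le_not_ge, node_le_node, node_le_node]

/-- The least node above an element. -/
def top : Net F → Fin 4
  | .node x => x
  | .pt e _ => F.hi e

/-- The greatest node below an element. -/
def bot : Net F → Fin 4
  | .node x => x
  | .pt e _ => F.lo e

theorem le_node_iff {x : Net F} {k : Fin 4} : x ≤ node k ↔ x.top ≤ k := by
  cases x <;> rfl

theorem node_le_iff {x : Net F} {k : Fin 4} : node k ≤ x ↔ k ≤ x.bot := by
  cases x <;> rfl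

/-- If `z` were on the edge of `x` and above it, then `y` would be on that edge too, or below its
lower end; either way `x` and `y` would be comparable. -/
theorem top_le_of_le {x y z : Net F} (hxy : ¬ x ≤ y) (hyx : ¬ y ≤ x) (hx : x ≤ z) (hy : y ≤ z) :
    node x.top ≤ z := by
  rcases z with z | ⟨e, i⟩
  · exact le_node_iff.1 hx
  · rcases x with x | ⟨d, k⟩
    · exact hx
    · rcases hx with ⟨rfl, -⟩ | hx
      · exfalso
        rcases y with y | ⟨c, l⟩
        · exact hyx hy
        · rcases hy with ⟨rfl, -⟩ | hy
          · rcases le_total k l with h | h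
            · exact hxy (Or.inl ⟨rfl, h⟩)
            · exact hyx (Or.inl ⟨rfl, h⟩)
          · exact hyx (Or.inr hy)
      · exact hx

theorem le_bot_of_le {x y z : Net F} (hxy : ¬ x ≤ y) (hyx : ¬ y ≤ x) (hx : z ≤ x) (hy : z ≤ y) :
    z ≤ node x.bot := by
  rcases z with z | ⟨e, i⟩
  · exact node_le_iff.1 hx
  · rcases x with x | ⟨d, k⟩
    · exact hx
    · rcases hx with ⟨rfl, -⟩ | hx
      · exfalso
        rcases y with y | ⟨c, l⟩
        · exact hxy hy
        · rcases hy with ⟨rfl, -⟩ | hy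
          · rcases le_total k l with h | h
            · exact hxy (Or.inl ⟨rfl, h⟩)
            · exact hyx (Or.inl ⟨rfl, h⟩)
          · exact hxy (Or.inr hy)
      · exact hx

-- An upper bound of two incomparable elements lies above the least node over each of them, so their
-- join is the larger of these two nodes. Meets are dual.
open Classical in
noncomputable instance : Lattice (Net F) where
  sup x y := if x ≤ y then y else if y ≤ x then x else node (max x.top y.top)
  inf x y := if x ≤ y then x else if y ≤ x then y else node (min x.bot y.bot)
  le_sup_left x y := by
    split_ifs with h h'
    · exact h
    · exact le_rfl
    · exact le_node_iff.2 (le_max_left _ _)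
  le_sup_right x y := by
    split_ifs with h h'
    · exact le_rfl
    · exact h'
    · exact le_node_iff.2 (le_max_right _ _)
  sup_le x y z hx hy := by
    split_ifs with h h'
    · exact hy
    · exact hx
    · rcases max_choice x.top y.top with h'' | h'' <;> rw [h'']
      · exact top_le_of_le h h' hx hy
      · exact top_le_of_le h' h hy hx
  inf_le_left x y := by
    split_ifs with h h'
    · exact le_rfl
    · exact h'
    · exact node_le_iff.2 (min_le_left _ _)
  inf_le_right x y := by
    split_ifs with h h'
    · exact h
    · exact le_rfl
    · exact node_le_iff.2 (min_le_right _ _)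
  le_inf z x y hx hy := by
    split_ifs with h h'
    · exact hx
    · exact hy
    · rcases min_choice x.bot y.bot with h'' | h'' <;> rw [h'']
      · exact le_bot_of_le h h' hx hy
      · exact le_bot_of_le h' h hy hx

-- Makes finite pieces of a net that contain all nodes sublattices; this is how lattices with
-- prescribed edge sizes are built.
open Classical in
theorem sup_mem {s : Set (Net F)} (hs : ∀ k, node k ∈ s) {x y : Net F} (hx : x ∈ s) (hy : y ∈ s) :
    x ⊔ y ∈ s := by
  change (if x ≤ y then y else if y ≤ x then x else node (max x.top y.top)) ∈ s
  split_ifs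
  · exact hy
  · exact hx
  · exact hs _

open Classical in
theorem inf_mem {s : Set (Net F)} (hs : ∀ k, node k ∈ s) {x y : Net F} (hx : x ∈ s) (hy : y ∈ s) :
    x ⊓ y ∈ s := by
  change (if x ≤ y then x else if y ≤ x then y else node (min x.bot y.bot)) ∈ s
  split_ifs
  · exact hx
  · exact hy
  · exact hs _

theorem le_pt_cases {z : Net F} {e : E} {i : ℕ} (h : z ≤ pt e i) :
    z ≤ node (F.lo e) ∨ ∃ k ≤ i, z = pt e k := by
  rcases z with z | ⟨d, k⟩
  · exact Or.inl h
  · rcases h with ⟨rfl, h⟩ | h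
    · exact Or.inr ⟨k, h, rfl⟩
    · exact Or.inl h

theorem pt_le_cases {z : Net F} {e : E} {i : ℕ} (h : pt e i ≤ z) :
    node (F.hi e) ≤ z ∨ ∃ k ≥ i, z = pt e k := by
  rcases z with z | ⟨d, k⟩
  · exact Or.inl h
  · rcases h with ⟨rfl, h⟩ | h
    · exact Or.inr ⟨k, h, rfl⟩
    · exact Or.inl h

end Net

namespace Frame

variable {E : Type*} (F : Frame E)

/-- Another edge runs between the ends of `e`, so that `e` must carry an element. -/
def Essential (e : E) : Prop := ∃ d, d ≠ e ∧ F.lo e ≤ F.lo d ∧ F.hi d ≤ F.hi e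

/-- Consecutive nodes are joined by an edge, and every node has two edges going up or two edges
coming from below. -/
structure Good : Prop where
  chain : ∀ k : Fin 3, ∃ e, F.lo e = k.castSucc ∧ F.hi e = k.succ
  branch : ∀ k, (∃ d e, d ≠ e ∧ F.lo d = k ∧ F.lo e = k) ∨ (∃ d e, d ≠ e ∧ F.hi d = k ∧ F.hi e = k)

end Frame

/-! ### Representations: nodes, edges and coverings -/

/-- A representation of the poset `P` as a set of elements of a net that contains all nodes and
meets all essential edges. -/
structure Rep {E : Type*} (F : Frame E) (P : Type*) [PartialOrder P] where
  emb : P ↪o Net F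
  nd : Fin 4 → P
  emb_nd : ∀ k, emb (nd k) = .node k
  exists_pt : ∀ e, F.Essential e → ∃ x i, emb x = .pt e i

namespace Rep

variable {E : Type*} {F : Frame E} {P : Type*} [PartialOrder P] (R : Rep F P)

/-- `x` lies on the edge `e`. -/
def On (e : E) (x : P) : Prop := ∃ i, R.emb x = .pt e i

theorem eq_nd {x : P} {k : Fin 4} (h : R.emb x = .node k) : x = R.nd k :=
  R.emb.injective (h.trans (R.emb_nd k).symm)

theorem nd_or_on (x : P) : (∃ k, x = R.nd k) ∨ ∃ e, R.On e x := by
  rcases h : R.emb x with k | ⟨e, i⟩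
  · exact Or.inl ⟨k, R.eq_nd h⟩
  · exact Or.inr ⟨e, i, h⟩

theorem nd_le_nd {k l : Fin 4} : R.nd k ≤ R.nd l ↔ k ≤ l := by
  rw [← R.emb.le_iff_le, R.emb_nd, R.emb_nd, Net.node_le_node]

theorem nd_lt_nd {k l : Fin 4} : R.nd k < R.nd l ↔ k < l := by
  rw [← R.emb.lt_iff_lt, R.emb_nd, R.emb_nd, Net.node_lt_node]

theorem nd_injective : Function.Injective R.nd := fun _ _ h =>
  le_antisymm (R.nd_le_nd.1 h.le) (R.nd_le_nd.1 h.ge)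

variable {R} {e : E} {x : P}

theorem On.unique {d : E} (hx : R.On e x) (hx' : R.On d x) : e = d := by
  obtain ⟨i, hi⟩ := hx
  obtain ⟨k, hk⟩ := hx'
  rw [hi] at hk
  cases hk
  rfl

theorem On.ne_nd (hx : R.On e x) (k : Fin 4) : x ≠ R.nd k := by
  rintro rfl
  obtain ⟨i, hi⟩ := hx
  rw [R.emb_nd] at hi
  cases hi

theorem On.nd_le_iff (hx : R.On e x) {k : Fin 4} : R.nd k ≤ x ↔ k ≤ F.lo e := by
  obtain ⟨i, hi⟩ := hx
  rw [← R.emb.le_iff_le, R.emb_nd, hi, Net.node_le_pt]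

theorem On.le_nd_iff (hx : R.On e x) {k : Fin 4} : x ≤ R.nd k ↔ F.hi e ≤ k := by
  obtain ⟨i, hi⟩ := hx
  rw [← R.emb.le_iff_le, R.emb_nd, hi, Net.pt_le_node]

theorem On.lo_lt (hx : R.On e x) : R.nd (F.lo e) < x :=
  lt_of_le_of_ne (hx.nd_le_iff.2 le_rfl) (hx.ne_nd _).symm

theorem On.lt_hi (hx : R.On e x) : x < R.nd (F.hi e) :=
  lt_of_le_of_ne (hx.le_nd_iff.2 le_rfl) (hx.ne_nd _)

theorem On.le_cases (hx : R.On e x) {y : P} (h : y ≤ x) : y ≤ R.nd (F.lo e) ∨ R.On e y := by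
  obtain ⟨i, hi⟩ := hx
  rw [← R.emb.le_iff_le, hi] at h
  rcases Net.le_pt_cases h with h | ⟨k, -, h⟩
  · rw [← R.emb_nd, R.emb.le_iff_le] at h
    exact Or.inl h
  · exact Or.inr ⟨k, h⟩

theorem On.ge_cases (hx : R.On e x) {y : P} (h : x ≤ y) : R.nd (F.hi e) ≤ y ∨ R.On e y := by
  obtain ⟨i, hi⟩ := hx
  rw [← R.emb.le_iff_le, hi] at h
  rcases Net.pt_le_cases h with h | ⟨k, -, h⟩
  · rw [← R.emb_nd, R.emb.le_iff_le] at h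
    exact Or.inl h
  · exact Or.inr ⟨k, h⟩

theorem On.le_total {y : P} (hx : R.On e x) (hy : R.On e y) : x ≤ y ∨ y ≤ x := by
  obtain ⟨i, hi⟩ := hx
  obtain ⟨k, hk⟩ := hy
  rw [← R.emb.le_iff_le, ← R.emb.le_iff_le, hi, hk]
  rcases Nat.le_total i k with h | h
  · exact Or.inl (Or.inl ⟨rfl, h⟩)
  · exact Or.inr (Or.inl ⟨rfl, h⟩)

theorem On.eq_of_lower {y z : P} (hx : R.On e x) (hy : y ⋖ x) (hz : z ⋖ x) : y = z := by
  have key : ∀ {y z : P}, y ⋖ x → z ⋖ x → y ≤ z := by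
    intro y z hy hz
    rcases hx.le_cases hy.le with h | h <;> rcases hx.le_cases hz.le with h' | h'
    · rw [(hz.eq_or_eq h' hx.lo_lt.le).resolve_right hx.lo_lt.ne] at h
      exact h
    · exact h.trans h'.lo_lt.le
    · exact absurd (h'.trans_lt h.lo_lt) (fun hlt => hz.2 hlt hy.lt)
    · rcases h.le_total h' with hh | hh
      · exact hh
      · rcases hh.eq_or_lt with hh | hh
        · exact hh.ge
        · exact absurd hy.lt (hz.2 hh)
  exact le_antisymm (key hy hz) (key hz hy)

theorem On.eq_of_upper {y z : P} (hx : R.On e x) (hy : x ⋖ y) (hz : x ⋖ z) : y = z := by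
  have key : ∀ {y z : P}, x ⋖ y → x ⋖ z → y ≤ z := by
    intro y z hy hz
    rcases hx.ge_cases hy.le with h | h <;> rcases hx.ge_cases hz.le with h' | h'
    · rw [(hy.eq_or_eq hx.lt_hi.le h).resolve_left hx.lt_hi.ne'] at h'
      exact h'
    · exact absurd (h'.lt_hi.trans_le h) (hy.2 hz.lt)
    · exact h.lt_hi.le.trans h'
    · rcases h.le_total h' with hh | hh
      · exact hh
      · rcases hh.eq_or_lt with hh | hh
        · exact hh.ge
        · exact absurd hh (hy.2 hz.lt)
  exact le_antisymm (key hy hz) (key hz hy)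

theorem On.irr (hx : R.On e x) : Irr x :=
  ⟨fun _ hy _ hz => hx.eq_of_lower hy hz, fun _ hy _ hz => hx.eq_of_upper hy hz⟩

theorem On.irrStar [Finite P] (hx : R.On e x) : IrrStar x := by
  obtain ⟨y, -, hy⟩ := exists_le_covBy_of_lt hx.lo_lt
  obtain ⟨z, hz, -⟩ := exists_covBy_le_of_lt hx.lt_hi
  exact ⟨⟨y, hy, fun _ h => hx.eq_of_lower h hy⟩, ⟨z, hz, fun _ h => hx.eq_of_upper h hz⟩⟩

variable (R)

theorem nd_covBy_nd (hF : F.Good) {d : E} (hd : ¬ F.Essential d) (h : ∀ x, ¬ R.On d x) :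
    R.nd (F.lo d) ⋖ R.nd (F.hi d) := by
  refine ⟨R.nd_lt_nd.2 (F.lt d), fun z hz hz' => ?_⟩
  rcases R.nd_or_on z with ⟨k, rfl⟩ | ⟨c, hc⟩
  · rw [R.nd_lt_nd] at hz hz'
    -- With a node strictly between the ends of `d`, the chain edge leaving `F.lo d` would lie
    -- inside `d` and make it essential.
    obtain ⟨c, hc, hc'⟩ := hF.chain ⟨F.lo d, by omega⟩
    refine hd ⟨c, ?_, ?_, ?_⟩
    · rintro rfl
      have := congrArg Fin.val hc'
      simp at this
      omega
    · rw [hc]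
      exact le_rfl
    · rw [hc', Fin.le_def]
      simp
      omega
  · by_cases hcd : c = d
    · exact h z (hcd ▸ hc)
    · exact hd ⟨c, hcd, hc.nd_le_iff.1 hz.le, hc.le_nd_iff.1 hz'.le⟩

/-- The covering belonging to an edge leads to its lowest element or, if the edge is empty and hence
inessential, directly to its upper end. -/
theorem exists_first [Finite P] (hF : F.Good) (e : E) :
    ∃ y, R.nd (F.lo e) ⋖ y ∧ (R.On e y ∨ (y = R.nd (F.hi e) ∧ ∀ x, ¬ R.On e x)) := by
  by_cases h : ∃ x, R.On e x
  · obtain ⟨x, hx⟩ := h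
    obtain ⟨y, hy, hyx⟩ := exists_covBy_le_of_lt hx.lo_lt
    exact ⟨y, hy, Or.inl ((hx.le_cases hyx).resolve_left hy.lt.not_ge)⟩
  · have hx : ∀ x, ¬ R.On e x := fun x hx => h ⟨x, hx⟩
    exact ⟨_, R.nd_covBy_nd hF (fun he => h (R.exists_pt e he)) hx, Or.inr ⟨rfl, hx⟩⟩

theorem exists_last [Finite P] (hF : F.Good) (e : E) :
    ∃ y, y ⋖ R.nd (F.hi e) ∧ (R.On e y ∨ (y = R.nd (F.lo e) ∧ ∀ x, ¬ R.On e x)) := by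
  by_cases h : ∃ x, R.On e x
  · obtain ⟨x, hx⟩ := h
    obtain ⟨y, hyx, hy⟩ := exists_le_covBy_of_lt hx.lt_hi
    exact ⟨y, hy, Or.inl ((hx.ge_cases hyx).resolve_left hy.lt.not_ge)⟩
  · have hx : ∀ x, ¬ R.On e x := fun x hx => h ⟨x, hx⟩
    exact ⟨_, R.nd_covBy_nd hF (fun he => h (R.exists_pt e he)) hx, Or.inr ⟨rfl, hx⟩⟩

theorem exists_on_of_parallel {d e : E} (hde : d ≠ e) (hlo : F.lo d = F.lo e)
    (hhi : F.hi d = F.hi e) : ∃ x, R.On e x :=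
  R.exists_pt e ⟨d, hde, hlo.ge, hhi.le⟩

/-- Two edges leaving a node yield two different upper covers. They could only coincide if both
edges were empty with the same upper end, but parallel edges are essential and carry elements. The
dual argument applies to edges arriving from below. -/
theorem not_irr_nd [Finite P] (hF : F.Good) (k : Fin 4) : ¬ Irr (R.nd k) := by
  rintro ⟨h1, h2⟩
  rcases hF.branch k with ⟨d, e, hde, rfl, he⟩ | ⟨d, e, hde, rfl, he⟩
  · obtain ⟨y, hy, hy'⟩ := R.exists_first hF d
    obtain ⟨z, hz, hz'⟩ := R.exists_first hF e
    rw [he] at hz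
    obtain rfl := h2 hy hz
    rcases hy' with hy' | ⟨hy', hn⟩ <;> rcases hz' with hz' | ⟨hz', hn'⟩
    · exact hde (hy'.unique hz')
    · exact hy'.ne_nd _ hz'
    · exact hz'.ne_nd _ hy'
    · obtain ⟨x, hx⟩ := R.exists_on_of_parallel hde he.symm (R.nd_injective (hy'.symm.trans hz'))
      exact hn' x hx
  · obtain ⟨y, hy, hy'⟩ := R.exists_last hF d
    obtain ⟨z, hz, hz'⟩ := R.exists_last hF e
    rw [he] at hz
    obtain rfl := h1 hy hz
    rcases hy' with hy' | ⟨hy', hn⟩ <;> rcases hz' with hz' | ⟨hz', hn'⟩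
    · exact hde (hy'.unique hz')
    · exact hy'.ne_nd _ hz'
    · exact hz'.ne_nd _ hy'
    · obtain ⟨x, hx⟩ := R.exists_on_of_parallel hde (R.nd_injective (hy'.symm.trans hz')) he.symm
      exact hn' x hx

theorem not_irr_iff [Finite P] (hF : F.Good) {x : P} : ¬ Irr x ↔ ∃ k, x = R.nd k := by
  constructor
  · intro h
    rcases R.nd_or_on x with h' | ⟨e, h'⟩
    · exact h'
    · exact absurd h'.irr h
  · rintro ⟨k, rfl⟩
    exact R.not_irr_nd hF k

theorem not_pendant [Finite P] (R : Rep F P) (hF : F.Good) (x : P) : ¬ Pendant x := by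
  intro h
  obtain ⟨a, ha⟩ := Set.ncard_eq_one.1 h
  have key : ∀ y z, (SimpleGraph.hasse P).Adj x y → (SimpleGraph.hasse P).Adj x z → y = z := by
    intro y z hy hz
    have hy' : y ∈ ({a} : Set P) := ha ▸ hy
    have hz' : z ∈ ({a} : Set P) := ha ▸ hz
    exact hy'.trans hz'.symm
  rcases R.nd_or_on x with ⟨k, rfl⟩ | ⟨e, hx⟩
  · refine R.not_irr_nd hF k ⟨fun y hy z hz => ?_, fun y hy z hz => ?_⟩
    · exact key y z (Or.inr hy) (Or.inr hz)
    · exact key y z (Or.inl hy) (Or.inl hz)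
  · obtain ⟨⟨y, hy, -⟩, ⟨z, hz, -⟩⟩ := hx.irrStar
    exact (hy.lt.trans hz.lt).ne (key y z (Or.inr hy) (Or.inl hz))

end Rep

/-! ### Retractible elements and basic blocks -/

theorem reflTransGen_covBy_of_le {P : Type*} [PartialOrder P] [Finite P] {x y : P} (h : x ≤ y) :
    Relation.ReflTransGen (· ⋖ ·) x y := by
  classical
  let _ := Fintype.ofFinite P
  let _ : LocallyFiniteOrder P := Fintype.toLocallyFiniteOrder
  exact le_iff_reflTransGen_covBy.1 h

/-- Used to refute the unique-path clause of `Retractible`: any further element between the two ends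
lies on another directed path. -/
theorem exists_path_through {P : Type*} [PartialOrder P] [Finite P] {x y z : P} (hxy : x ≤ y)
    (hyz : y ≤ z) : ∃ l : List P, l.IsChain (· ⋖ ·) ∧ l.head? = some x ∧ l.getLast? = some z ∧
      y ∈ l := by
  obtain ⟨l, hl, hl'⟩ := List.exists_isChain_cons_of_relationReflTransGen
    (reflTransGen_covBy_of_le hxy)
  obtain ⟨m, hm, hm'⟩ := List.exists_isChain_cons_of_relationReflTransGen
    (reflTransGen_covBy_of_le hyz)
  have hlast : (x :: l).getLast? = some y := by
    rw [List.getLast?_eq_getLast_of_ne_nil (List.cons_ne_nil _ _), hl']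
  refine ⟨(x :: l) ++ m, ?_, by simp, ?_, ?_⟩
  · rw [List.isChain_append]
    refine ⟨hl, hm.tail, ?_⟩
    intro a ha b hb
    rw [hlast, Option.mem_some_iff] at ha
    subst ha
    cases m with
    | nil => simp at hb
    | cons c m =>
      simp only [List.head?_cons, Option.mem_some_iff] at hb
      subst hb
      exact (List.isChain_cons_cons.1 hm).1
  · cases m with
    | nil =>
      simp only [List.getLast_singleton] at hm'
      rw [List.append_nil, hlast, hm']
    | cons c m =>
      rw [List.getLast?_append_of_ne_nil _ (List.cons_ne_nil _ _),
        List.getLast?_eq_getLast_of_ne_nil (List.cons_ne_nil _ _), ← hm', List.getLast_cons_cons]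
  · exact List.mem_append_left _ (List.mem_of_getLast? hlast)

namespace Rep

variable {E : Type*} {F : Frame E} {P : Type*} [PartialOrder P]

/-- A representation of a subposet gives one of a smaller subposet. -/
def restrict {S T : Set P} (R : Rep F S) (hTS : T ⊆ S) (hnd : ∀ k, (R.nd k : P) ∈ T)
    (hpt : ∀ e, F.Essential e → ∃ x : S, (x : P) ∈ T ∧ R.On e x) : Rep F T where
  emb := OrderEmbedding.ofMapLEIff (fun x => R.emb ⟨x, hTS x.2⟩) (fun _ _ => R.emb.le_iff_le)
  nd k := ⟨R.nd k, hnd k⟩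
  emb_nd k := R.emb_nd k
  exists_pt e he := by
    obtain ⟨x, hx, i, hi⟩ := hpt e he
    exact ⟨⟨x, hx⟩, i, hi⟩

theorem lower_covBy_of_alone {R : Rep F P} {e : E} {x : P} (hx : R.On e x)
    (h : ∀ y, R.On e y → y = x) : R.nd (F.lo e) ⋖ x := by
  refine ⟨hx.lo_lt, fun z hz hz' => ?_⟩
  rcases hx.le_cases hz'.le with hh | hh
  · exact hz.not_ge hh
  · exact hz'.ne (h z hh)

theorem upper_covBy_of_alone {R : Rep F P} {e : E} {x : P} (hx : R.On e x)
    (h : ∀ y, R.On e y → y = x) : x ⋖ R.nd (F.hi e) := by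
  refine ⟨hx.lt_hi, fun z hz hz' => ?_⟩
  rcases hx.ge_cases hz.le with hh | hh
  · exact hz'.not_ge hh
  · exact hz.ne' (h z hh)

/-- The only element of an essential edge is not retractible. -/
theorem not_retractible_of_alone [Finite P] (R : Rep F P) (hF : F.Good) {e : E} {x : P}
    (he : F.Essential e) (hx : R.On e x) (h : ∀ y, R.On e y → y = x) : ¬ Retractible x := by
  have h1 := lower_covBy_of_alone hx h
  have h2 := upper_covBy_of_alone hx h
  -- The edge `d` that makes `e` essential supplies `w`: an end of `d` strictly inside the interval
  -- or, if `d` is parallel to `e`, an element on `d`.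
  have hw : ∃ w, w ≠ x ∧ R.nd (F.lo e) < w ∧ w < R.nd (F.hi e) := by
    obtain ⟨d, hde, hlo, hhi⟩ := he
    rcases hlo.lt_or_eq with hlo' | hlo'
    · exact ⟨_, (hx.ne_nd _).symm, R.nd_lt_nd.2 hlo', R.nd_lt_nd.2 ((F.lt d).trans_le hhi)⟩
    rcases hhi.lt_or_eq with hhi' | hhi'
    · exact ⟨_, (hx.ne_nd _).symm, R.nd_lt_nd.2 (hlo.trans_lt (F.lt d)), R.nd_lt_nd.2 hhi'⟩
    · obtain ⟨w, hw⟩ := R.exists_on_of_parallel hde.symm hlo' hhi'.symm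
      refine ⟨w, ?_, hlo' ▸ hw.lo_lt, hhi' ▸ hw.lt_hi⟩
      rintro rfl
      exact hde (hw.unique hx)
  rintro ⟨-, hr | ⟨y, z, -, -, hy, hz, hr⟩⟩
  · exact hr ⟨_, _, R.not_irr_nd hF _, R.not_irr_nd hF _, h1, h2⟩
  · obtain rfl := hx.eq_of_lower hy h1
    obtain rfl := hx.eq_of_upper hz h2
    obtain ⟨w, hwx, hw1, hw2⟩ := hw
    obtain ⟨l, hl, hl1, hl2, hwl⟩ := exists_path_through hw1.le hw2.le
    rw [hr l hl hl1 hl2] at hwl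
    simp only [List.mem_cons, List.not_mem_nil, or_false] at hwl
    rcases hwl with rfl | rfl | rfl
    · exact lt_irrefl _ hw1
    · exact hwx rfl
    · exact lt_irrefl _ hw2

/-- The removed element is irreducible, hence not a node, and it is not alone on an essential edge,
so the restricted embedding still meets every requirement. -/
theorem of_retractStep [Finite P] (hF : F.Good) {S T : Set P} (R : Rep F S)
    (h : RetractStep S T) : Nonempty (Rep F T) := by
  obtain ⟨x, hx, hr, rfl⟩ := h
  have hxk : ∀ k, R.nd k ≠ x := by
    rintro k rfl
    exact R.not_irr_nd hF k hr.1
  refine ⟨R.restrict Set.sdiff_subset (fun k => ⟨(R.nd k).2, fun h => hxk k (Subtype.ext h)⟩) ?_⟩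
  intro e he
  by_contra! hcon
  have hcon' : ∀ y, R.On e y → y = x := by
    intro y hy
    by_contra hyx
    exact hcon y ⟨y.2, fun h => hyx (Subtype.ext h)⟩ hy
  obtain ⟨y, hy⟩ := R.exists_pt e he
  have hyx := hcon' y hy
  subst hyx
  exact R.not_retractible_of_alone hF he hy hcon' hr

theorem of_retract [Finite P] (hF : F.Good) (R : Rep F P) {S : Set P}
    (h : Relation.ReflTransGen RetractStep Set.univ S) : Nonempty (Rep F S) := by
  induction h with
  | refl =>
    exact ⟨⟨(OrderIso.Set.univ (α := P)).toOrderEmbedding.trans R.emb,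
      fun k => ⟨R.nd k, trivial⟩, fun k => R.emb_nd k, fun e he => by
        obtain ⟨x, i, hi⟩ := R.exists_pt e he
        exact ⟨⟨x, trivial⟩, i, hi⟩⟩⟩
  | tail _ h ih =>
    obtain ⟨R'⟩ := ih
    exact R'.of_retractStep hF h

/-- A represented poset has no pendant vertex, so the second phase of the construction removes
nothing and the basic block is the basic retract. -/
theorem of_isBasicBlockOf [Finite P] (hF : F.Good) (R : Rep F P) {S : Set P}
    (h : IsBasicBlockOf S) : Nonempty (Rep F S) ∧ ∀ x : S, IrrStar x → ¬ Retractible x := by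
  obtain ⟨T, ⟨hT, hT'⟩, hTS, -⟩ := h
  obtain ⟨R'⟩ := R.of_retract hF hT
  have : S = T := by
    rcases Relation.ReflTransGen.cases_head hTS with h | ⟨U, ⟨x, hx, -⟩, -⟩
    · exact h.symm
    · exact absurd hx (R'.not_pendant hF x)
  subst this
  exact ⟨⟨R'⟩, hT'⟩

theorem exists_isBasicBlockOf [Finite P] (hF : F.Good) (R : Rep F P) :
    ∃ S : Set P, IsBasicBlockOf S := by
  obtain ⟨S, hS, hmin⟩ := (Set.toFinite
    {S : Set P | Relation.ReflTransGen RetractStep Set.univ S}).exists_minimal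
      ⟨Set.univ, Relation.ReflTransGen.refl⟩
  obtain ⟨R'⟩ := R.of_retract hF hS
  refine ⟨S, S, ⟨hS, fun x hx hr => ?_⟩, Relation.ReflTransGen.refl, R'.not_pendant hF⟩
  have h : RetractStep S (S \ {(x : P)}) := ⟨x, hx, hr, rfl⟩
  exact (hmin (Relation.ReflTransGen.tail hS h) Set.sdiff_subset x.2).2 rfl

/-- An edge with two elements carries a retractible element. -/
theorem eq_of_not_retractible [Finite P] (hF : F.Good) (R : Rep F P)
    (h : ∀ x : P, IrrStar x → ¬ Retractible x) {e : E} {x y : P} (hx : R.On e x)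
    (hy : R.On e y) : x = y := by
  have key : ∀ {x y : P}, R.On e x → R.On e y → ¬ x < y := by
    intro x y hx hy hxy
    -- The upper cover of `x` is still at most `y`, so it is not a node; hence `x` is retractible by
    -- the first alternative.
    refine h x hx.irrStar ⟨hx.irr, Or.inl ?_⟩
    rintro ⟨a, b, -, hb, -, hxb⟩
    obtain ⟨k, rfl⟩ := (R.not_irr_iff hF).1 hb
    obtain ⟨z, hz, hzy⟩ := exists_covBy_le_of_lt hxy
    rw [hx.eq_of_upper hz hxb, hy.nd_le_iff] at hzy
    exact ((hx.le_nd_iff.1 hxb.le).trans hzy).not_gt (F.lt e)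
  rcases hx.le_total hy with hh | hh
  · exact hh.eq_of_not_lt (key hx hy)
  · exact (hh.eq_of_not_lt (key hy hx)).symm

/-- An inessential edge carries no element once no element is retractible. -/
theorem not_on_of_not_retractible [Finite P] (hF : F.Good) (R : Rep F P)
    (h : ∀ x : P, IrrStar x → ¬ Retractible x) {e : E} (he : ¬ F.Essential e) (x : P) :
    ¬ R.On e x := by
  intro hx
  have hal : ∀ y, R.On e y → y = x := fun y hy => R.eq_of_not_retractible hF h hy hx
  have h1 := lower_covBy_of_alone hx hal
  have h2 := upper_covBy_of_alone hx hal
  -- A node or an element of another edge strictly between the ends would make `e` essential. So `x`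
  -- is alone in the open interval, and the path through it is the only one.
  have hbt : ∀ w, R.nd (F.lo e) < w → w < R.nd (F.hi e) → w = x := by
    intro w hw hw'
    rcases R.nd_or_on w with ⟨k, rfl⟩ | ⟨c, hc⟩
    · rw [R.nd_lt_nd] at hw hw'
      obtain ⟨c, hc, hc'⟩ := hF.chain ⟨F.lo e, by omega⟩
      refine absurd ⟨c, ?_, ?_, ?_⟩ he
      · rintro rfl
        have := congrArg Fin.val hc'
        simp at this
        omega
      · rw [hc]
        exact le_rfl
      · rw [hc', Fin.le_def]
        simp
        omega
    · by_cases hce : c = e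
      · exact hal w (hce ▸ hc)
      · exact absurd ⟨c, hce, hc.nd_le_iff.1 hw.le, hc.le_nd_iff.1 hw'.le⟩ he
  refine h x hx.irrStar ⟨hx.irr, Or.inr ⟨_, _, R.not_irr_nd hF _, R.not_irr_nd hF _, h1, h2, ?_⟩⟩
  intro l hl hl1 hl2
  -- A path of coverings ascends, so it stays below its last element and stops on reaching it.
  have hle : ∀ (a : P) (m : List P), (a :: m).IsChain (· ⋖ ·) →
      (a :: m).getLast? = some (R.nd (F.hi e)) →
      a ≤ R.nd (F.hi e) ∧ (a = R.nd (F.hi e) → m = []) := by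
    intro a m
    induction m generalizing a with
    | nil =>
      intro _ hm
      simp only [List.getLast?_singleton, Option.some.injEq] at hm
      exact ⟨hm.le, fun _ => rfl⟩
    | cons b m ih =>
      intro hc hm
      rw [List.isChain_cons_cons] at hc
      rw [List.getLast?_cons_cons] at hm
      have := hc.1.lt.trans_le (ih b hc.2 hm).1
      exact ⟨this.le, fun h => absurd h this.ne⟩
  match l, hl, hl1, hl2 with
  | [], _, hl1, _ => simp at hl1
  | [a], _, hl1, hl2 =>
    simp only [List.head?_cons, Option.some.injEq, List.getLast?_singleton] at hl1 hl2
    exact absurd (hl1.symm.trans hl2) (h1.lt.trans h2.lt).ne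
  | a :: b :: m, hl, hl1, hl2 =>
    simp only [List.head?_cons, Option.some.injEq] at hl1
    subst hl1
    rw [List.isChain_cons_cons] at hl
    rw [List.getLast?_cons_cons] at hl2
    have hb : b = x := by
      rcases (hle b m hl.2 hl2).1.eq_or_lt with hb | hb
      · exact absurd h2.lt (hb ▸ hl.1.2 h1.lt)
      · exact hbt b hl.1.lt hb
    subst hb
    match m, hl, hl2 with
    | [], _, hl2 =>
      simp only [List.getLast?_singleton, Option.some.injEq] at hl2
      exact absurd hl2 h2.lt.ne
    | c :: m, hl, hl2 =>
      obtain rfl := hx.eq_of_upper (List.isChain_cons_cons.1 hl.2).1 h2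
      rw [List.getLast?_cons_cons] at hl2
      rw [(hle _ m (List.isChain_cons_cons.1 hl.2).2 hl2).2 rfl]

end Rep

/-! ### Frames with three extra edges and their classification -/

/-- The frame with the three edges joining consecutive nodes and three further edges. -/
def frame (p : Fin 3 → {q : Fin 4 × Fin 4 // q.1 < q.2}) : Frame (Fin 3 ⊕ Fin 3) where
  lo := Sum.elim Fin.castSucc (fun c => (p c).1.1)
  hi := Sum.elim Fin.succ (fun c => (p c).1.2)
  lt := by
    rintro (k | c)
    · exact Fin.castSucc_lt_succ
    · exact (p c).2

/-- None of the pairs consists of consecutive nodes. -/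
def Wide (p : Fin 3 → {q : Fin 4 × Fin 4 // q.1 < q.2}) : Prop :=
  ∀ c, ((p c).1.1 : ℕ) + 1 < (p c).1.2

section Frames

variable {p : Fin 3 → {q : Fin 4 × Fin 4 // q.1 < q.2}}

@[simp] theorem frame_lo_inl (k : Fin 3) : (frame p).lo (.inl k) = k.castSucc := rfl
@[simp] theorem frame_hi_inl (k : Fin 3) : (frame p).hi (.inl k) = k.succ := rfl
@[simp] theorem frame_lo_inr (c : Fin 3) : (frame p).lo (.inr c) = (p c).1.1 := rfl
@[simp] theorem frame_hi_inr (c : Fin 3) : (frame p).hi (.inr c) = (p c).1.2 := rfl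

/-- The chain edge leaving the lower end of the pair runs within it. -/
theorem frame_essential_inr (c : Fin 3) : (frame p).Essential (.inr c) := by
  have h := (p c).2
  refine ⟨.inl ⟨(p c).1.1, by omega⟩, by simp, le_rfl, ?_⟩
  rw [frame_hi_inl, frame_hi_inr, Fin.le_def]
  exact h

theorem frame_not_essential_inl (hp : Wide p) (k : Fin 3) : ¬ (frame p).Essential (.inl k) := by
  rintro ⟨d | c, hd, hlo, hhi⟩
  · rw [frame_lo_inl, frame_lo_inl, Fin.le_def] at hlo
    rw [frame_hi_inl, frame_hi_inl, Fin.le_def] at hhi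
    simp only [Fin.val_castSucc, Fin.val_succ] at hlo hhi
    exact hd (congrArg _ (Fin.ext (by omega)))
  · have := hp c
    rw [frame_lo_inl, frame_lo_inr, Fin.le_def] at hlo
    rw [frame_hi_inl, frame_hi_inr, Fin.le_def] at hhi
    simp only [Fin.val_castSucc, Fin.val_succ] at hlo hhi
    omega

theorem basicPairs_wide (i : Fin 3) : Wide (basicPairs i) := by
  intro c
  revert i c
  decide

theorem frame_basicPairs_good (i : Fin 3) : (frame (basicPairs i)).Good where
  chain k := ⟨.inl k, rfl, rfl⟩
  branch := by
    revert i
    decide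

/-- The edge lists of good frames without short extra edges. -/
theorem exists_basicPairs_of_good (hp : Wide p) (hF : (frame p).Good) :
    ∃ (i : Fin 3) (σ : Equiv.Perm (Fin 3)), ∀ c, p (σ c) = basicPairs i c := by
  let val : Fin 3 → {q : Fin 4 × Fin 4 // q.1 < q.2} :=
    ![⟨(0, 2), by decide⟩, ⟨(1, 3), by decide⟩, ⟨(0, 3), by decide⟩]
  have hval : ∀ q : {q : Fin 4 × Fin 4 // q.1 < q.2}, (q.1.1 : ℕ) + 1 < q.1.2 → ∃ a, q = val a := by
    decide
  choose q hq using fun c => hval (p c) (hp c)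
  -- Among the wide pairs only (0,2) touches node 2, and the chain edges alone give that node one
  -- edge up and one down. Below, (1,3) is forced by node 1 in the same way.
  have h0 : ∃ c, q c = 0 := by
    by_contra! hcon
    have hc : ∀ c, (p c).1.2 ≠ 2 ∧ (p c).1.1 ≠ 2 := by
      intro c
      rw [hq c]
      have := hcon c
      revert this
      generalize q c = a
      revert a
      decide
    rcases hF.branch 2 with ⟨d | d, e | e, hde, h, h'⟩ | ⟨d | d, e | e, hde, h, h'⟩
    · exact hde (congrArg _ (Fin.castSucc_injective _ (h.trans h'.symm)))
    · exact (hc e).2 h'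
    · exact (hc d).2 h
    · exact (hc d).2 h
    · exact hde (congrArg _ (Fin.succ_injective _ (h.trans h'.symm)))
    · exact (hc e).1 h'
    · exact (hc d).1 h
    · exact (hc d).1 h
  have h1 : ∃ c, q c = 1 := by
    by_contra! hcon
    have hc : ∀ c, (p c).1.2 ≠ 1 ∧ (p c).1.1 ≠ 1 := by
      intro c
      rw [hq c]
      have := hcon c
      revert this
      generalize q c = a
      revert a
      decide
    rcases hF.branch 1 with ⟨d | d, e | e, hde, h, h'⟩ | ⟨d | d, e | e, hde, h, h'⟩
    · exact hde (congrArg _ (Fin.castSucc_injective _ (h.trans h'.symm)))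
    · exact (hc e).2 h'
    · exact (hc d).2 h
    · exact (hc d).2 h
    · exact hde (congrArg _ (Fin.succ_injective _ (h.trans h'.symm)))
    · exact (hc e).1 h'
    · exact (hc d).1 h
    · exact (hc d).1 h
  -- The values 0 and 1 both occur and the third is arbitrary, which leaves three multisets; `code
  -- i` lists the one of `basicPairs i` in terms of `val`.
  let code : Fin 3 → Fin 3 → Fin 3 := ![![1, 0, 0], ![0, 1, 1], ![0, 1, 2]]
  have hcode : ∀ i c, basicPairs i c = val (code i c) := by decide
  have key : ∀ q : Fin 3 → Fin 3, (∃ c, q c = 0) → (∃ c, q c = 1) →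
      ∃ (i : Fin 3) (σ : Equiv.Perm (Fin 3)), ∀ c, q (σ c) = code i c := by
    decide
  obtain ⟨i, σ, h⟩ := key q h0 h1
  exact ⟨i, σ, fun c => by rw [hq, h, hcode]⟩

end Frames

/-! ### Height of the basic block -/

theorem four_le_krullDim {P : Type*} [PartialOrder P] {a b c d e : P} (hab : a < b) (hbc : b < c)
    (hcd : c < d) (hde : d < e) : 4 ≤ Order.krullDim P := by
  refine (Order.le_krullDim_iff (n := 4)).2 ⟨⟨4, ![a, b, c, d, e], ?_⟩, rfl⟩
  intro i
  fin_cases i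
  · exact hab
  · exact hbc
  · exact hcd
  · exact hde

namespace Rep

variable {p : Fin 3 → {q : Fin 4 × Fin 4 // q.1 < q.2}} {P : Type*} [PartialOrder P]

/-- An extra edge between consecutive nodes is parallel to a chain edge, which then carries an
element; with the four nodes this makes a chain of five. -/
theorem wide_of_krullDim (R : Rep (frame p) P) (h : Order.krullDim P = 3) : Wide p := by
  intro c
  by_contra hc
  have hlt := (p c).2
  rw [Fin.lt_def] at hlt
  obtain ⟨k, hk⟩ : ∃ k : Fin 3, k.castSucc = (p c).1.1 := ⟨⟨(p c).1.1, by omega⟩, rfl⟩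
  have hk' : k.succ = (p c).1.2 := by
    apply Fin.ext
    rw [Fin.val_succ, ← Fin.val_castSucc, hk]
    omega
  obtain ⟨x, hx⟩ := R.exists_pt (.inl k) ⟨.inr c, by simp, hk.le, hk'.ge⟩
  have hx' : R.On (.inl k) x := hx
  have h1 := hx'.lo_lt
  have h2 := hx'.lt_hi
  have h01 : R.nd 0 < R.nd 1 := R.nd_lt_nd.2 (by decide)
  have h12 : R.nd 1 < R.nd 2 := R.nd_lt_nd.2 (by decide)
  have h23 : R.nd 2 < R.nd 3 := R.nd_lt_nd.2 (by decide)
  have h4 : 4 ≤ Order.krullDim P := by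
    fin_cases k
    · exact four_le_krullDim h1 h2 h12 h23
    · exact four_le_krullDim h01 h1 h2 h23
    · exact four_le_krullDim h01 h12 h1 h2
  rw [h] at h4
  exact absurd h4 (by decide)

/-- A fully retracted poset is the adjunct of the chain with one-element chains. -/
theorem nonempty_orderIso_chainAdjunct [Finite P] (hp : Wide p) (hF : (frame p).Good)
    (R : Rep (frame p) P) (h : ∀ x : P, IrrStar x → ¬ Retractible x) :
    Nonempty (P ≃o ChainAdjunct p) := by
  have hinl : ∀ k x, ¬ R.On (.inl k) x := fun k x =>
    R.not_on_of_not_retractible hF h (frame_not_essential_inl hp k) x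
  have hpt : ∀ c : Fin 3, ∃ x, R.On (.inr c) x := fun c => R.exists_pt _ (frame_essential_inr c)
  choose f hf using hpt
  let g : ChainAdjunct p → P
    | .chain k => R.nd k
    | .pt c => f c
  have hg : ∀ a b, g a ≤ g b ↔ a ≤ b := by
    rintro (k | c) (l | d)
    · exact R.nd_le_nd
    · exact (hf d).nd_le_iff
    · exact (hf c).le_nd_iff
    · change f c ≤ f d ↔ c = d ∨ (p c).1.2 ≤ (p d).1.1
      constructor
      · intro hcd
        rcases (hf c).ge_cases hcd with hh | hh
        · exact Or.inr ((hf d).nd_le_iff.1 hh)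
        · exact Or.inl (Sum.inr_injective (hh.unique (hf d)))
      · rintro (rfl | hh)
        · exact le_rfl
        · exact (hf c).lt_hi.le.trans ((hf d).nd_le_iff.2 hh)
  have hsurj : Function.Surjective g := by
    intro x
    rcases R.nd_or_on x with ⟨k, rfl⟩ | ⟨k | c, hx⟩
    · exact ⟨.chain k, rfl⟩
    · exact absurd hx (hinl k x)
    · exact ⟨.pt c, R.eq_of_not_retractible hF h (hf c) hx⟩
  exact ⟨(RelIso.ofSurjective (OrderEmbedding.ofMapLEIff g hg) hsurj).symm⟩

end Rep

theorem krullDim_fin_four : Order.krullDim (Fin 4) = 3 := by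
  apply le_antisymm
  · refine iSup_le fun l => ?_
    have := Fintype.card_le_of_injective l l.strictMono.injective
    simp only [Fintype.card_fin] at this
    exact_mod_cast (by omega : l.length ≤ 3)
  · exact (Order.le_krullDim_iff (n := 3)).2 ⟨⟨3, id, fun i => Fin.castSucc_lt_succ⟩, rfl⟩

theorem krullDim_chainAdjunct {p : Fin 3 → {q : Fin 4 × Fin 4 // q.1 < q.2}} (hp : Wide p) :
    Order.krullDim (ChainAdjunct p) = 3 := by
  have h4 : Order.krullDim (Fin 4) = 3 := krullDim_fin_four
  rw [← h4]
  apply le_antisymm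
  · let f : ChainAdjunct p → Fin 4
      | .chain k => k
      | .pt c => ⟨(p c).1.1 + 1, by have := hp c; omega⟩
    refine Order.krullDim_le_of_strictMono f ?_
    intro x y hxy
    have hle : ChainAdjunct.le x y := hxy.le
    have hnle : ¬ ChainAdjunct.le y x := hxy.not_ge
    rcases x with x | c <;> rcases y with y | d <;> simp only [ChainAdjunct.le] at hle hnle
    · exact not_le.1 hnle
    · rw [Fin.lt_def]
      rw [Fin.le_def] at hle
      exact Nat.lt_succ_of_le hle
    · have := hp c
      rw [Fin.lt_def]
      rw [Fin.le_def] at hle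
      exact this.trans_le hle
    · have := hp c
      rcases hle with rfl | hle
      · exact absurd (Or.inl rfl) hnle
      · rw [Fin.lt_def]
        rw [Fin.le_def] at hle
        change ((p c).1.1 : ℕ) + 1 < (p d).1.1 + 1
        omega
  · refine Order.krullDim_le_of_strictMono (ChainAdjunct.chain (p := p)) ?_
    exact fun x y hxy => lt_of_le_not_ge (show x ≤ y from hxy.le) (show ¬ y ≤ x from hxy.not_ge)

/-! ### Isomorphisms and edge sizes -/

theorem irr_orderIso_iff {P Q : Type*} [PartialOrder P] [PartialOrder Q] (g : P ≃o Q) {x : P} :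
    Irr (g x) ↔ Irr x := by
  refine ⟨fun h => ?_, fun h => ?_⟩
  · obtain ⟨h1, h2⟩ := h
    refine ⟨fun y hy z hz => g.injective (h1 ?_ ?_), fun y hy z hz => g.injective (h2 ?_ ?_)⟩ <;>
      exact (apply_covBy_apply_iff g).2 ‹_›
  · obtain ⟨h1, h2⟩ := h
    refine ⟨fun y hy z hz => g.symm.injective (h1 ?_ ?_),
      fun y hy z hz => g.symm.injective (h2 ?_ ?_)⟩ <;>
    · refine (apply_covBy_apply_iff g).1 ?_
      rwa [g.apply_symm_apply]

theorem nonempty_orderIso_of_card_eq {α β : Type*} [PartialOrder α] [PartialOrder β] [Finite α]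
    [Finite β] (hα : ∀ x y : α, x ≤ y ∨ y ≤ x) (hβ : ∀ x y : β, x ≤ y ∨ y ≤ x)
    (h : Nat.card α = Nat.card β) : Nonempty (α ≃o β) := by
  classical
  let _ : LinearOrder α := { ‹PartialOrder α› with
    le_total := hα
    toDecidableLE := Classical.decRel _ }
  let _ : LinearOrder β := { ‹PartialOrder β› with
    le_total := hβ
    toDecidableLE := Classical.decRel _ }
  let _ := Fintype.ofFinite α
  let _ := Fintype.ofFinite β
  rw [Nat.card_eq_fintype_card] at h
  exact ⟨(Fintype.orderIsoFinOfCardEq α h).symm.trans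
    (Fintype.orderIsoFinOfCardEq β Nat.card_eq_fintype_card.symm)⟩

namespace Rep

section

variable {E : Type*} {F : Frame E} {P Q : Type*} [PartialOrder P] [PartialOrder Q]

/-- The number of elements on an edge. -/
noncomputable def size (R : Rep F P) (e : E) : ℕ := Nat.card {x // R.On e x}

/-- Transport of a representation along a relabelling of the edges. -/
def relabel {E' : Type*} {F' : Frame E'} (R : Rep F P) (ε : E ≃ E')
    (hlo : ∀ e, F'.lo (ε e) = F.lo e) (hhi : ∀ e, F'.hi (ε e) = F.hi e) : Rep F' P where
  emb := R.emb.trans <| OrderEmbedding.ofMapLEIff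
    (fun | .node k => .node k
         | .pt e i => .pt (ε e) i) (by
      rintro (k | ⟨e, i⟩) (l | ⟨d, m⟩) <;> simp [hlo, hhi])
  nd := R.nd
  emb_nd k := by simp [R.emb_nd]
  exists_pt e' he' := by
    obtain ⟨d', hd', h1, h2⟩ := he'
    obtain ⟨e, rfl⟩ := ε.surjective e'
    obtain ⟨d, rfl⟩ := ε.surjective d'
    rw [hlo, hlo] at h1
    rw [hhi, hhi] at h2
    obtain ⟨x, i, hi⟩ := R.exists_pt e ⟨d, fun h => hd' (h ▸ rfl), h1, h2⟩
    exact ⟨x, i, by simp [hi]⟩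

theorem relabel_on {E' : Type*} {F' : Frame E'} (R : Rep F P) (ε : E ≃ E')
    (hlo : ∀ e, F'.lo (ε e) = F.lo e) (hhi : ∀ e, F'.hi (ε e) = F.hi e) (e : E) (x : P) :
    (R.relabel ε hlo hhi).On (ε e) x ↔ R.On e x := by
  simp only [On, relabel, RelEmbedding.coe_trans, Function.comp_apply,
    OrderEmbedding.coe_ofMapLEIff]
  rcases R.emb x with k | ⟨d, i⟩ <;> simp

theorem relabel_size {E' : Type*} {F' : Frame E'} (R : Rep F P) (ε : E ≃ E')
    (hlo : ∀ e, F'.lo (ε e) = F.lo e) (hhi : ∀ e, F'.hi (ε e) = F.hi e) (e : E) :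
    (R.relabel ε hlo hhi).size (ε e) = R.size e :=
  Nat.card_congr (Equiv.subtypeEquivRight fun x => R.relabel_on ε hlo hhi e x)

theorem card_eq [Finite P] [Fintype E] (R : Rep F P) : Nat.card P = 4 + ∑ e, R.size e := by
  let f : Fin 4 ⊕ (Σ e, {x // R.On e x}) → P := Sum.elim R.nd (fun q => q.2.1)
  have hf : Function.Bijective f := by
    constructor
    · rintro (k | ⟨e, x, hx⟩) (l | ⟨d, y, hy⟩) h
      · exact congrArg _ (R.nd_injective h)
      · exact absurd h.symm (hy.ne_nd k)
      · exact absurd h (hx.ne_nd l)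
      · obtain rfl : x = y := h
        obtain rfl := hx.unique hy
        rfl
    · intro x
      rcases R.nd_or_on x with ⟨k, rfl⟩ | ⟨e, hx⟩
      · exact ⟨.inl k, rfl⟩
      · exact ⟨.inr ⟨e, x, hx⟩, rfl⟩
  rw [← Nat.card_congr (Equiv.ofBijective f hf), Nat.card_sum, Nat.card_sigma]
  simp [size]

/-- Posets represented in the same frame with the same numbers of elements on the edges are
isomorphic. -/
theorem nonempty_orderIso_of_size_eq [Finite P] [Finite Q] (R : Rep F P) (R' : Rep F Q)
    (h : ∀ e, R.size e = R'.size e) : Nonempty (P ≃o Q) := by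
  have hiso : ∀ e, Nonempty ({x // R.On e x} ≃o {x // R'.On e x}) := fun e =>
    nonempty_orderIso_of_card_eq (fun x y => x.2.le_total y.2) (fun x y => x.2.le_total y.2) (h e)
  let g := fun e => (hiso e).some
  have hf : ∀ x : P, ∃ y : Q, (∀ k, x = R.nd k → y = R'.nd k) ∧
      ∀ e (hx : R.On e x), y = g e ⟨x, hx⟩ := by
    intro x
    rcases R.nd_or_on x with ⟨k, rfl⟩ | ⟨e, hx⟩
    · exact ⟨R'.nd k, fun l hl => by rw [R.nd_injective hl], fun e hx => absurd rfl (hx.ne_nd k)⟩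
    · refine ⟨g e ⟨x, hx⟩, fun k hk => absurd hk (hx.ne_nd k), fun d hx' => ?_⟩
      obtain rfl := hx.unique hx'
      rfl
  choose f hf1 hf2 using hf
  have hnd : ∀ k, f (R.nd k) = R'.nd k := fun k => hf1 _ k rfl
  have hon : ∀ {e x}, R.On e x → R'.On e (f x) := fun {e x} hx => hf2 x e hx ▸ (g e ⟨x, hx⟩).2
  -- On one edge the order is that of `g e`; between different edges a comparison passes through a
  -- node.
  have hle : ∀ x y, f x ≤ f y ↔ x ≤ y := by
    intro x y
    rcases R.nd_or_on x with ⟨k, rfl⟩ | ⟨e, hx⟩ <;> rcases R.nd_or_on y with ⟨l, rfl⟩ | ⟨d, hy⟩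
    · rw [hnd, hnd, R.nd_le_nd, R'.nd_le_nd]
    · rw [hnd, hy.nd_le_iff, (hon hy).nd_le_iff]
    · rw [hnd, hx.le_nd_iff, (hon hx).le_nd_iff]
    · by_cases hed : e = d
      · subst hed
        rw [hf2 x e hx, hf2 y e hy, Subtype.coe_le_coe, (g e).le_iff_le, Subtype.mk_le_mk]
      · constructor
        · intro hh
          rcases (hon hx).ge_cases hh with hh | hh
          · exact hx.lt_hi.le.trans (hy.nd_le_iff.2 ((hon hy).nd_le_iff.1 hh))
          · exact absurd (hh.unique (hon hy)) hed
        · intro hh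
          rcases hx.ge_cases hh with hh | hh
          · exact (hon hx).lt_hi.le.trans ((hon hy).nd_le_iff.2 (hy.nd_le_iff.1 hh))
          · exact absurd (hh.unique hy) hed
  have hsurj : Function.Surjective f := by
    intro y
    rcases R'.nd_or_on y with ⟨k, rfl⟩ | ⟨e, hy⟩
    · exact ⟨R.nd k, hnd k⟩
    · refine ⟨(g e).symm ⟨y, hy⟩, ?_⟩
      rw [hf2 _ e ((g e).symm ⟨y, hy⟩).2]
      simp
  exact ⟨RelIso.ofSurjective (OrderEmbedding.ofMapLEIff f hle) hsurj⟩

end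

section

variable {E E' : Type*} {F : Frame E} {F' : Frame E'} {P Q : Type*} [PartialOrder P]
  [PartialOrder Q] [Finite P] [Finite Q] (R : Rep F P) (R' : Rep F' Q)

/-- Nodes are exactly the elements that are not doubly irreducible, so an isomorphism induces an
automorphism of the four-chain, which is the identity. -/
theorem orderIso_nd (hF : F.Good) (hF' : F'.Good) (g : P ≃o Q) (k : Fin 4) :
    g (R.nd k) = R'.nd k := by
  have h1 : ∀ k, ∃ l, g (R.nd k) = R'.nd l := fun k =>
    (R'.not_irr_iff hF').1 (by rw [irr_orderIso_iff]; exact R.not_irr_nd hF k)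
  have h2 : ∀ k, ∃ l, g.symm (R'.nd k) = R.nd l := fun k =>
    (R.not_irr_iff hF).1 (by rw [irr_orderIso_iff]; exact R'.not_irr_nd hF' k)
  choose a ha using h1
  choose b hb using h2
  have hma : StrictMono a := fun k l hkl => by
    rwa [← R'.nd_lt_nd, ← ha, ← ha, g.lt_iff_lt, R.nd_lt_nd]
  have hmb : StrictMono b := fun k l hkl => by
    rwa [← R.nd_lt_nd, ← hb, ← hb, g.symm.lt_iff_lt, R'.nd_lt_nd]
  have hab : b (a k) = k := R.nd_injective (by rw [← hb, ← ha, g.symm_apply_apply])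
  have h := hmb.le_apply (x := a k)
  rw [hab] at h
  rw [ha, le_antisymm h hma.le_apply]

variable {R R'}

/-- The ends of an edge can be read off from the nodes below and above any element on it. -/
theorem On.orderIso (hF : F.Good) (hF' : F'.Good) (g : P ≃o Q) {e : E} {x : P} (hx : R.On e x) :
    ∃ e', R'.On e' (g x) ∧ F'.lo e' = F.lo e ∧ F'.hi e' = F.hi e := by
  rcases R'.nd_or_on (g x) with ⟨k, hk⟩ | ⟨e', he'⟩
  · rw [← R.orderIso_nd R' hF hF' g] at hk
    exact absurd (g.injective hk) (hx.ne_nd k)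
  · have h1 : ∀ k, k ≤ F'.lo e' ↔ k ≤ F.lo e := fun k => by
      rw [← hx.nd_le_iff, ← he'.nd_le_iff, ← R.orderIso_nd R' hF hF' g, g.le_iff_le]
    have h2 : ∀ k, F'.hi e' ≤ k ↔ F.hi e ≤ k := fun k => by
      rw [← hx.le_nd_iff, ← he'.le_nd_iff, ← R.orderIso_nd R' hF hF' g, g.le_iff_le]
    exact ⟨e', he', le_antisymm ((h1 _).1 le_rfl) ((h1 _).2 le_rfl),
      le_antisymm ((h2 _).2 le_rfl) ((h2 _).1 le_rfl)⟩

/-- Elements of one edge are comparable, whereas comparable elements of different edges are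
separated by a node; edges with the same ends therefore cannot mix. -/
theorem On.orderIso_same (hF : F.Good) (hF' : F'.Good) (g : P ≃o Q) {e : E} {e' : E'} {x y : P}
    (hx : R.On e x) (hy : R.On e y) (hx' : R'.On e' (g x)) : R'.On e' (g y) := by
  obtain ⟨c, hc, hc1, hc2⟩ := hx.orderIso hF hF' g (R' := R')
  obtain rfl := hc.unique hx'
  obtain ⟨d, hd, hd1, hd2⟩ := hy.orderIso hF hF' g (R' := R')
  rcases hx.le_total hy with h | h
  · rcases hc.ge_cases (g.le_iff_le.2 h) with h | h
    · rw [hd.nd_le_iff, hd1, hc2] at h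
      exact absurd h (F.lt e).not_ge
    · exact h
  · rcases hc.le_cases (g.le_iff_le.2 h) with h | h
    · rw [hd.le_nd_iff, hd2, hc1] at h
      exact absurd h (F.lt e).not_ge
    · exact h

theorem On.orderIso_size (hF : F.Good) (hF' : F'.Good) (g : P ≃o Q) {e : E} {e' : E'} {x : P}
    (hx : R.On e x) (hx' : R'.On e' (g x)) : R.size e = R'.size e' := by
  refine Nat.card_congr (g.toEquiv.subtypeEquiv fun y => ⟨fun hy => ?_, fun hy => ?_⟩)
  · exact hx.orderIso_same hF hF' g hy hx'
  · have hx'' : R.On e (g.symm (g x)) := by rwa [g.symm_apply_apply]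
    have := hx'.orderIso_same hF' hF g.symm hy hx''
    rwa [OrderIso.coe_toEquiv, g.symm_apply_apply] at this

end

section

variable {p p' : Fin 3 → {q : Fin 4 × Fin 4 // q.1 < q.2}} {P Q : Type*} [PartialOrder P]
  [PartialOrder Q] [Finite P] [Finite Q] {R : Rep (frame p) P} {R' : Rep (frame p') Q}

/-- No extra edge of the target joins consecutive nodes, so the elements of a chain edge stay on
that chain edge. The inverse isomorphism gives the opposite inequality. -/
theorem size_inl_le (hp' : Wide p') (hF : (frame p).Good) (hF' : (frame p').Good) (g : P ≃o Q)
    (k : Fin 3) : R.size (.inl k) ≤ R'.size (.inl k) := by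
  by_cases h : ∃ x, R.On (.inl k) x
  · obtain ⟨x, hx⟩ := h
    obtain ⟨d | c, he', hlo, hhi⟩ := hx.orderIso hF hF' g (R' := R')
    · obtain rfl : d = k := Fin.castSucc_injective _ hlo
      exact (hx.orderIso_size hF hF' g he').le
    · have := hp' c
      rw [← frame_lo_inr, ← frame_hi_inr, hlo, hhi] at this
      simp at this
  · have : IsEmpty {x // R.On (.inl k) x} := ⟨fun x => h ⟨x.1, x.2⟩⟩
    simp [size]

/-- An isomorphism matches the edges of the two representations. -/
theorem exists_perm_of_orderIso (hp : Wide p) (hp' : Wide p') (hF : (frame p).Good)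
    (hF' : (frame p').Good) (g : P ≃o Q) :
    (∀ k, R.size (.inl k) = R'.size (.inl k)) ∧ ∃ σ : Equiv.Perm (Fin 3),
      ∀ c, p' (σ c) = p c ∧ R'.size (.inr (σ c)) = R.size (.inr c) := by
  refine ⟨fun k => le_antisymm (size_inl_le hp' hF hF' g k) (size_inl_le hp hF' hF g.symm k), ?_⟩
  have hpt : ∀ c : Fin 3, ∃ x, R.On (.inr c) x := fun c => R.exists_pt _ (frame_essential_inr c)
  choose f hf using hpt
  have hs : ∀ c, ∃ d, R'.On (.inr d) (g (f c)) ∧ p' d = p c := by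
    intro c
    obtain ⟨k | d, he', hlo, hhi⟩ := (hf c).orderIso hF hF' g (R' := R')
    · have := hp c
      rw [← frame_lo_inr, ← frame_hi_inr, ← hlo, ← hhi] at this
      simp at this
    · exact ⟨d, he', Subtype.ext (Prod.ext hlo hhi)⟩
  choose s hs1 hs2 using hs
  have hinj : Function.Injective s := by
    intro c d hcd
    have h1 := hs1 d
    rw [← hcd] at h1
    have hx : R.On (.inr c) (g.symm (g (f c))) := by
      rw [g.symm_apply_apply]
      exact hf c
    have := (hs1 c).orderIso_same hF' hF g.symm h1 hx
    rw [g.symm_apply_apply] at this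
    exact Sum.inr_injective (this.unique (hf d))
  refine ⟨Equiv.ofBijective s (Finite.injective_iff_bijective.1 hinj), fun c => ⟨hs2 c, ?_⟩⟩
  exact ((hf c).orderIso_size hF hF' g (hs1 c)).symm

end

/-! ### Lattices with prescribed edge sizes -/

/-- The subset of a net with `s e` elements on every edge `e`, represented by itself. -/
def ofSize {E : Type*} (F : Frame E) (s : E → ℕ) (hs : ∀ e, F.Essential e → 0 < s e) :
    Rep F {z : Net F | ∀ e i, z = .pt e i → i < s e} where
  emb := OrderEmbedding.subtype _
  nd k := ⟨.node k, fun _ _ h => nomatch h⟩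
  emb_nd _ := rfl
  exists_pt e he := ⟨⟨.pt e 0, fun _ _ h => by cases h; exact hs e he⟩, 0, rfl⟩

theorem ofSize_size {E : Type*} (F : Frame E) (s : E → ℕ) (hs : ∀ e, F.Essential e → 0 < s e)
    (e : E) : (ofSize F s hs).size e = s e := by
  let f : Fin (s e) → {x // (ofSize F s hs).On e x} := fun i =>
    ⟨⟨.pt e i, fun _ _ h => by cases h; exact i.2⟩, i, rfl⟩
  have hf : Function.Bijective f := by
    constructor
    · intro i k h
      have := congrArg (fun z => z.1.1) h
      simp only [f, Net.pt.injEq, true_and] at this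
      exact Fin.ext this
    · rintro ⟨⟨z, hz⟩, i, hi⟩
      have hi' : z = .pt e i := hi
      subst hi'
      exact ⟨⟨i, hz e i rfl⟩, rfl⟩
  rw [size, ← Nat.card_congr (Equiv.ofBijective f hf), Nat.card_eq_fintype_card, Fintype.card_fin]

theorem finite_ofSize {E : Type*} [Finite E] (F : Frame E) (s : E → ℕ) :
    Finite {z : Net F | ∀ e i, z = .pt e i → i < s e} := by
  let f : Fin 4 ⊕ (Σ e, Fin (s e)) → {z : Net F | ∀ e i, z = .pt e i → i < s e} :=
    Sum.elim (fun k => ⟨.node k, fun _ _ h => nomatch h⟩)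
      (fun q => ⟨.pt q.1 q.2, fun _ _ h => by cases h; exact q.2.2⟩)
  refine Finite.of_surjective f ?_
  rintro ⟨k | ⟨e, i⟩, hz⟩
  · exact ⟨.inl k, rfl⟩
  · exact ⟨.inr ⟨e, i, hz e i rfl⟩, rfl⟩

/-- Transport of a representation of a lattice to a type in bijection with it. -/
theorem exists_lattice_of_equiv {E : Type*} {F : Frame E} {T X : Type*} [Lattice T] (R : Rep F T)
    (φ : X ≃ T) : ∃ _ : Lattice X, ∃ R' : Rep F X, ∀ e, R'.size e = R.size e := by
  let L : Lattice X := φ.lattice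
  let R' : Rep F X :=
    { emb := OrderEmbedding.ofMapLEIff (fun x => R.emb (φ x)) (fun x y => R.emb.le_iff_le)
      nd := fun k => φ.symm (R.nd k)
      emb_nd := fun k => by
        change R.emb (φ (φ.symm (R.nd k))) = _
        rw [φ.apply_symm_apply, R.emb_nd]
      exists_pt := fun e he => by
        obtain ⟨x, i, hi⟩ := R.exists_pt e he
        refine ⟨φ.symm x, i, ?_⟩
        change R.emb (φ (φ.symm x)) = _
        rw [φ.apply_symm_apply, hi] }
  exact ⟨L, R', fun e => Nat.card_congr (φ.subtypeEquiv fun x => Iff.rfl)⟩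

/-- There is a lattice on `n` elements with prescribed numbers of elements on the edges. -/
theorem exists_lattice {E : Type*} [Fintype E] (F : Frame E) (s : E → ℕ)
    (hs : ∀ e, F.Essential e → 0 < s e) {n : ℕ} (hn : n = 4 + ∑ e, s e) :
    ∃ L : Lattice (Fin n), ∃ R : @Rep E F (Fin n) L.toPartialOrder,
      ∀ e, @size E F (Fin n) L.toPartialOrder R e = s e := by
  have := finite_ofSize F s
  have hnd : ∀ k, Net.node k ∈ {z : Net F | ∀ e i, z = .pt e i → i < s e} :=
    fun k _ _ h => nomatch h
  let _ : Lattice {z : Net F | ∀ e i, z = .pt e i → i < s e} :=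
    Subtype.lattice (fun _ _ => Net.sup_mem hnd) (fun _ _ => Net.inf_mem hnd)
  let R := ofSize F s hs
  have hR : ∀ e, R.size e = s e := ofSize_size F s hs
  have hc : Nat.card {z : Net F | ∀ e i, z = .pt e i → i < s e} = n := by
    rw [R.card_eq, hn]
    simp_rw [hR]
  obtain ⟨L, R', h⟩ := R.exists_lattice_of_equiv (Finite.equivFinOfCardEq hc).symm
  exact ⟨L, R', fun e => (h e).trans (hR e)⟩

end Rep

/-! ### Reducible elements, nullity and blocks -/

section Reducible

variable {L : Type*} [Lattice L] [Finite L] {a : L}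

/-- Two distinct upper covers of `a` meet in `a`; a unique upper cover would lie below every pair of
elements strictly above `a`. -/
theorem meetReducible_iff : MeetReducible a ↔ ¬ {z : L | a ⋖ z}.Subsingleton := by
  constructor
  · rintro ⟨b, c, hb, hc, h⟩ hs
    have hab : a < b := lt_of_le_of_ne (h ▸ inf_le_left) hb.symm
    have hac : a < c := lt_of_le_of_ne (h ▸ inf_le_right) hc.symm
    obtain ⟨y, hy, hyb⟩ := exists_covBy_le_of_lt hab
    obtain ⟨z, hz, hzc⟩ := exists_covBy_le_of_lt hac
    have hyz : y = z := hs hy hz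
    subst hyz
    exact hy.lt.not_ge (h ▸ le_inf hyb hzc)
  · intro h
    obtain ⟨b, hb, c, hc, hbc⟩ := Set.not_subsingleton_iff.1 h
    refine ⟨b, c, hb.1.ne', hc.1.ne', ?_⟩
    rcases CovBy.eq_or_eq hb (le_inf hb.1.le hc.1.le) inf_le_left with h' | h'
    · exact h'
    · exact absurd ((CovBy.eq_or_eq hc hb.1.le (inf_eq_left.1 h')).resolve_left hb.1.ne') hbc

theorem joinReducible_iff : JoinReducible a ↔ ¬ {z : L | z ⋖ a}.Subsingleton := by
  constructor
  · rintro ⟨b, c, hb, hc, h⟩ hs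
    have hab : b < a := lt_of_le_of_ne (h ▸ le_sup_left) hb
    have hac : c < a := lt_of_le_of_ne (h ▸ le_sup_right) hc
    obtain ⟨y, hyb, hy⟩ := exists_le_covBy_of_lt hab
    obtain ⟨z, hzc, hz⟩ := exists_le_covBy_of_lt hac
    have hyz : y = z := hs hy hz
    subst hyz
    exact hy.lt.not_ge (h ▸ sup_le hyb hzc)
  · intro h
    obtain ⟨b, hb, c, hc, hbc⟩ := Set.not_subsingleton_iff.1 h
    refine ⟨b, c, hb.1.ne, hc.1.ne, ?_⟩
    rcases CovBy.eq_or_eq hb le_sup_left (sup_le hb.1.le hc.1.le) with h' | h'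
    · exact absurd ((CovBy.eq_or_eq hc (sup_eq_left.1 h') hb.1.le).resolve_right hb.1.ne) hbc
    · exact h'

theorem reducible_iff : Reducible a ↔ ¬ Irr a := by
  rw [Reducible, meetReducible_iff, joinReducible_iff, Irr]
  tauto

end Reducible

section Nullity

variable {P : Type*} [PartialOrder P] [Finite P]

theorem card_connectedComponent_hasse {b : P} (hb : IsBot b) :
    Nat.card (SimpleGraph.hasse P).ConnectedComponent = 1 := by
  have hreach : ∀ x, (SimpleGraph.hasse P).Reachable b x := by
    intro x
    induction reflTransGen_covBy_of_le (hb x) with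
    | refl => exact SimpleGraph.Reachable.refl _
    | tail _ h ih => exact ih.trans (SimpleGraph.Adj.reachable (Or.inl h))
  rw [Nat.card_eq_one_iff_unique]
  refine ⟨⟨?_⟩, ⟨(SimpleGraph.hasse P).connectedComponentMk b⟩⟩
  intro c d
  induction c using SimpleGraph.ConnectedComponent.ind with | h x => ?_
  induction d using SimpleGraph.ConnectedComponent.ind with | h y => ?_
  exact SimpleGraph.ConnectedComponent.sound ((hreach x).symm.trans (hreach y))

theorem ncard_edgeSet_hasse {P : Type*} [PartialOrder P] :
    (SimpleGraph.hasse P).edgeSet.ncard = Nat.card {q : P × P // q.1 ⋖ q.2} := by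
  let f : {q : P × P // q.1 ⋖ q.2} → (SimpleGraph.hasse P).edgeSet := fun q =>
    ⟨s(q.1.1, q.1.2), Or.inl q.2⟩
  have hf : Function.Bijective f := by
    constructor
    · rintro ⟨⟨a, b⟩, h⟩ ⟨⟨c, d⟩, h'⟩ heq
      have heq' := congrArg Subtype.val heq
      simp only [f, Sym2.eq_iff] at heq'
      rcases heq' with ⟨rfl, rfl⟩ | ⟨rfl, rfl⟩
      · rfl
      · exact absurd (h.lt.trans h'.lt) (lt_irrefl _)
    · rintro ⟨s, hs⟩
      induction s using Sym2.ind with | _ a b => ?_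
      rcases hs with hs | hs
      · exact ⟨⟨(a, b), hs⟩, rfl⟩
      · exact ⟨⟨(b, a), hs⟩, Subtype.ext Sym2.eq_swap⟩
  rw [← Nat.card_coe_set_eq]
  exact (Nat.card_congr (Equiv.ofBijective f hf)).symm

/-- If all elements outside the range of `r` have exactly one upper cover, then the nullity is
determined by the number of coverings that start in the range of `r`. -/
theorem nullity_eq {b : P} (hb : IsBot b) {n : ℕ} {r : Fin n → P} (hr : Function.Injective r)
    (h : ∀ x, x ∉ Set.range r → ∃! z, x ⋖ z) :
    nullity P = Nat.card {q : Fin n × P // r q.1 ⋖ q.2} - n + 1 := by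
  choose f hf hf' using fun x : {x // x ∉ Set.range r} => h x.1 x.2
  -- Each element outside the range contributes one vertex and one edge (its unique upper covering),
  -- so these cancel in the nullity.
  let g : {q : Fin n × P // r q.1 ⋖ q.2} ⊕ {x // x ∉ Set.range r} → {q : P × P // q.1 ⋖ q.2} :=
    Sum.elim (fun q => ⟨(r q.1.1, q.1.2), q.2⟩) (fun x => ⟨(x.1, f x), hf x⟩)
  have hg : Function.Bijective g := by
    constructor
    · rintro (⟨⟨k, y⟩, hk⟩ | ⟨x, hx⟩) (⟨⟨l, z⟩, hl⟩ | ⟨x', hx'⟩) heq <;>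
        simp only [g, Sum.elim_inl, Sum.elim_inr, Subtype.mk.injEq, Prod.mk.injEq] at heq
      · obtain ⟨h1, rfl⟩ := heq
        obtain rfl := hr h1
        rfl
      · exact absurd ⟨k, heq.1⟩ hx'
      · exact absurd ⟨l, heq.1.symm⟩ hx
      · obtain ⟨rfl, -⟩ := heq
        rfl
    · rintro ⟨⟨x, y⟩, hxy⟩
      by_cases hx : x ∈ Set.range r
      · obtain ⟨k, rfl⟩ := hx
        exact ⟨.inl ⟨(k, y), hxy⟩, rfl⟩
      · refine ⟨.inr ⟨x, hx⟩, Subtype.ext (Prod.ext rfl ?_)⟩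
        exact (hf' ⟨x, hx⟩ y hxy).symm
  let g' : Fin n ⊕ {x // x ∉ Set.range r} → P := Sum.elim r Subtype.val
  have hg' : Function.Bijective g' := by
    constructor
    · rintro (k | ⟨x, hx⟩) (l | ⟨x', hx'⟩) heq
      · exact congrArg _ (hr heq)
      · exact absurd ⟨k, heq⟩ hx'
      · exact absurd ⟨l, heq.symm⟩ hx
      · exact congrArg _ (Subtype.ext heq)
    · intro x
      by_cases hx : x ∈ Set.range r
      · obtain ⟨k, rfl⟩ := hx
        exact ⟨.inl k, rfl⟩
      · exact ⟨.inr ⟨x, hx⟩, rfl⟩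
  have h1 := Nat.card_congr (Equiv.ofBijective g hg)
  have h2 := Nat.card_congr (Equiv.ofBijective g' hg')
  rw [Nat.card_sum] at h1 h2
  rw [Nat.card_eq_fintype_card, Fintype.card_fin] at h2
  rw [nullity, card_connectedComponent_hasse hb, ncard_edgeSet_hasse, ← h1, ← h2]
  push_cast
  ring

end Nullity

namespace Rep

variable {E : Type*} {F : Frame E} {P : Type*} [PartialOrder P] [Finite P]

/-- An edge corresponds to the covering at its lower end. Conversely, the upper element of a
covering lies on the edge in question, or is a node reached along an empty chain edge. -/
theorem card_coverings (R : Rep F P) (hF : F.Good) :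
    Nat.card {q : Fin 4 × P // R.nd q.1 ⋖ q.2} = Nat.card E := by
  choose f hf hf' using R.exists_first hF
  let g : E → {q : Fin 4 × P // R.nd q.1 ⋖ q.2} := fun e => ⟨(F.lo e, f e), hf e⟩
  have hg : Function.Bijective g := by
    constructor
    · intro d e hde
      simp only [g, Subtype.mk.injEq, Prod.mk.injEq] at hde
      obtain ⟨h1, h2⟩ := hde
      rcases hf' d with hd | ⟨hd, hd'⟩ <;> rcases hf' e with he | ⟨he, he'⟩
      · exact (h2 ▸ hd).unique he
      · exact absurd (h2.trans he) (hd.ne_nd _)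
      · exact absurd (h2.symm.trans hd) (he.ne_nd _)
      · by_contra hne
        obtain ⟨x, hx⟩ := R.exists_on_of_parallel hne h1
          (R.nd_injective (hd.symm.trans (h2.trans he)))
        exact he' x hx
    · rintro ⟨⟨k, y⟩, hky⟩
      have hky' : R.nd k ⋖ y := hky
      rcases R.nd_or_on y with ⟨l, rfl⟩ | ⟨e, hy⟩
      · have hkl := R.nd_lt_nd.1 hky'.lt
        obtain ⟨e, he, he'⟩ := hF.chain ⟨k, by omega⟩
        have hk : F.lo e = k := he
        have hl : F.hi e ≤ l := by
          rw [he', Fin.le_def]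
          simp
          omega
        refine ⟨e, Subtype.ext (Prod.ext hk ?_)⟩
        change f e = R.nd l
        have hfe := hf e
        rw [hk] at hfe
        have hle : f e ≤ R.nd l := by
          rcases hf' e with h | ⟨h, -⟩
          · exact h.le_nd_iff.2 hl
          · rw [h]
            exact R.nd_le_nd.2 hl
        exact (hky'.eq_or_eq hfe.le hle).resolve_left hfe.lt.ne'
      · have hk : F.lo e = k := R.nd_injective
          ((hky'.eq_or_eq (R.nd_le_nd.2 (hy.nd_le_iff.1 hky'.le)) hy.lo_lt.le).resolve_right
            hy.lo_lt.ne)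
        refine ⟨e, Subtype.ext (Prod.ext hk ?_)⟩
        change f e = y
        have hfe := hf e
        rw [hk] at hfe
        rcases hf' e with h | ⟨-, h⟩
        · rcases h.le_total hy with hh | hh
          · exact (hky'.eq_or_eq hfe.le hh).resolve_left hfe.lt.ne'
          · exact ((hfe.eq_or_eq hky'.le hh).resolve_left hky'.lt.ne').symm
        · exact absurd hy (h y)
  exact (Nat.card_congr (Equiv.ofBijective g hg)).symm

end Rep

theorem Rep.isRCBlock {p : Fin 3 → {q : Fin 4 × Fin 4 // q.1 < q.2}} {L : Type*} [Lattice L]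
    [Finite L] (R : Rep (frame p) L) (hF : (frame p).Good) : IsRCBlock L 4 3 := by
  have hred : {a : L | Reducible a} = Set.range R.nd := by
    ext x
    rw [Set.mem_ofPred_eq, reducible_iff, R.not_irr_iff hF]
    exact ⟨fun ⟨k, hk⟩ => ⟨k, hk.symm⟩, fun ⟨k, hk⟩ => ⟨k, hk.symm⟩⟩
  have hbot : IsBot (R.nd 0) := by
    intro x
    rcases R.nd_or_on x with ⟨k, rfl⟩ | ⟨e, hx⟩
    · exact R.nd_le_nd.2 (Fin.zero_le _)
    · exact hx.nd_le_iff.2 (Fin.zero_le _)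
  have htop : IsTop (R.nd 3) := by
    intro x
    rcases R.nd_or_on x with ⟨k, rfl⟩ | ⟨e, hx⟩
    · exact R.nd_le_nd.2 (Fin.le_last _)
    · exact hx.le_nd_iff.2 (Fin.le_last _)
  refine ⟨⟨⟨_, htop, ?_⟩, ⟨_, hbot, ?_⟩⟩, ?_, ?_, ?_⟩
  · rw [joinReducible_iff]
    exact fun h => R.not_irr_nd hF 3 ⟨h, fun y hy => absurd (htop y) hy.lt.not_ge⟩
  · rw [meetReducible_iff]
    exact fun h => R.not_irr_nd hF 0 ⟨fun y hy => absurd (hbot y) hy.lt.not_ge, h⟩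
  · rw [hred, ← Set.image_univ, Set.ncard_image_of_injective _ R.nd_injective, Set.ncard_univ]
    simp
  · rw [hred]
    rintro _ ⟨k, rfl⟩ _ ⟨l, rfl⟩ -
    exact (le_total k l).imp R.nd_le_nd.2 R.nd_le_nd.2
  -- Six edges give nullity `6 - 4 + 1 = 3`.
  · rw [nullity_eq hbot R.nd_injective, R.card_coverings hF]
    · simp
    · intro x hx
      rcases R.nd_or_on x with ⟨k, rfl⟩ | ⟨e, he⟩
      · exact absurd ⟨k, rfl⟩ hx
      · exact he.irrStar.2

/-! ### From blocks to representations -/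

section Comparable

variable {P : Type*} [PartialOrder P] [Finite P]

/-- Descending from `x` there is a single lower cover at every step until `y` is reached, so any `z
≤ x` is met on the way or lies below `y`. -/
theorem comparable_of_lower {x y z : P} (hy : y ≤ x) (hz : z ≤ x)
    (h : ∀ w, y ≤ w → w ≤ x → Irr w) : y ≤ z ∨ z ≤ y := by
  induction x using WellFoundedLT.induction with | ind x ih => ?_
  rcases hy.eq_or_lt with rfl | hy'
  · exact Or.inr hz
  rcases hz.eq_or_lt with rfl | hz'
  · exact Or.inl hy
  obtain ⟨a, hya, ha⟩ := exists_le_covBy_of_lt hy'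
  obtain ⟨b, hzb, hb⟩ := exists_le_covBy_of_lt hz'
  obtain rfl := (h x hy le_rfl).1 ha hb
  exact ih a ha.lt hya hzb fun w hw hw' => h w hw (hw'.trans ha.le)

theorem comparable_of_upper {x y z : P} (hy : x ≤ y) (hz : x ≤ z)
    (h : ∀ w, x ≤ w → w ≤ y → Irr w) : y ≤ z ∨ z ≤ y := by
  induction x using WellFoundedGT.induction with | ind x ih => ?_
  rcases hy.eq_or_lt with rfl | hy'
  · exact Or.inl hz
  rcases hz.eq_or_lt with rfl | hz'
  · exact Or.inr hy
  obtain ⟨a, ha, hya⟩ := exists_covBy_le_of_lt hy'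
  obtain ⟨b, hb, hzb⟩ := exists_covBy_le_of_lt hz'
  obtain rfl := (h x le_rfl hy).2 ha hb
  exact ih a ha.lt hya hzb fun w hw hw' => h w (ha.le.trans hw) hw'

end Comparable

/-- A finite bounded poset whose elements with several lower or several upper covers form a
four-element chain containing the bounds is represented in the frame of the coverings starting
in this chain. -/
theorem exists_rep_of_chain {P : Type*} [PartialOrder P] [Finite P] {r : Fin 4 → P}
    (hr : ∀ k l, r k ≤ r l ↔ k ≤ l) (hirr : ∀ x, ¬ Irr x ↔ ∃ k, x = r k) (hbot : IsBot (r 0))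
    (htop : IsTop (r 3)) :
    ∃ F : Frame {q : Fin 4 × P // r q.1 ⋖ q.2}, F.Good ∧ Nonempty (Rep F P) := by
  classical
  have hinj : Function.Injective r := fun k l h =>
    le_antisymm ((hr k l).1 h.le) ((hr l k).1 h.ge)
  have hlt : ∀ k l, r k < r l ↔ k < l := fun k l => by
    rw [lt_iff_le_not_ge, lt_iff_le_not_ge, hr, hr]
  have hlo : ∀ x, ∃ k, ∀ l, r l ≤ x ↔ l ≤ k := by
    intro x
    obtain ⟨k, hk, hmax⟩ := (Set.toFinite {l | r l ≤ x}).exists_maximal ⟨0, hbot x⟩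
    refine ⟨k, fun l => ⟨fun hl => ?_, fun hl => ((hr _ _).2 hl).trans hk⟩⟩
    exact (le_total l k).elim id (fun h => hmax hl h)
  have hhi : ∀ x, ∃ k, ∀ l, x ≤ r l ↔ k ≤ l := by
    intro x
    obtain ⟨k, hk, hmin⟩ := (Set.toFinite {l | x ≤ r l}).exists_minimal ⟨3, htop x⟩
    refine ⟨k, fun l => ⟨fun hl => ?_, fun hl => hk.trans ((hr _ _).2 hl)⟩⟩
    exact (le_total k l).elim id (fun h => hmin hl h)
  choose lo hlo using hlo
  choose hi hhi using hhi
  have lo_le : ∀ x, r (lo x) ≤ x := fun x => (hlo x _).2 le_rfl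
  have le_hi : ∀ x, x ≤ r (hi x) := fun x => (hhi x _).2 le_rfl
  have hi_r : ∀ k, hi (r k) = k := fun k =>
    le_antisymm ((hhi _ _).1 le_rfl) ((hr _ _).1 (le_hi _))
  have hne : ∀ {x}, Irr x → ∀ k, x ≠ r k := fun hx k hk => (hirr _).2 ⟨k, hk⟩ hx
  have lo_lt : ∀ {x}, Irr x → r (lo x) < x := fun hx =>
    lt_of_le_of_ne (lo_le _) (hne hx _).symm
  have irr_of : ∀ {x}, (∀ k, x ≠ r k) → Irr x := fun h =>
    by_contra fun hx => by
      obtain ⟨k, hk⟩ := (hirr _).1 hx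
      exact h k hk
  let F : Frame {q : Fin 4 × P // r q.1 ⋖ q.2} :=
    { lo := fun q => q.1.1
      hi := fun q => hi q.1.2
      lt := fun q => (hlt _ _).1 (q.2.lt.trans_le (le_hi _)) }
  -- the part of the lower set of an irreducible element above its greatest lower node
  have down_irr : ∀ {x z}, z ≤ x → ¬ z ≤ r (lo x) → ∀ w, z ≤ w → w ≤ x → Irr w := by
    intro x z _ hz w hzw hwx
    refine irr_of fun k hk => hz (hzw.trans ?_)
    subst hk
    exact (hr _ _).2 ((hlo _ _).1 hwx)
  have down_lo : ∀ {x z}, z ≤ x → ¬ z ≤ r (lo x) → lo z = lo x := by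
    intro x z hzx hz
    have h := (comparable_of_lower hzx (lo_le x) (down_irr hzx hz)).resolve_left hz
    exact le_antisymm ((hlo _ _).1 ((lo_le z).trans hzx)) ((hlo _ _).1 h)
  -- `st x` is the first element of the path carrying `x`. The covering from `r (lo x)` to `st x`
  -- names the edge of `x`.
  have hy : ∀ x, ∃ y, Irr x → r (lo x) ⋖ y ∧ y ≤ x := by
    intro x
    by_cases hx : Irr x
    · obtain ⟨y, hy⟩ := exists_covBy_le_of_lt (lo_lt hx)
      exact ⟨y, fun _ => hy⟩
    · exact ⟨x, fun h => absurd h hx⟩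
  choose st hst using hy
  have st_irr : ∀ {x} (_ : Irr x) (w), st x ≤ w → w ≤ x → Irr w := fun hx =>
    down_irr (hst _ hx).2 (hst _ hx).1.lt.not_ge
  have hi_st : ∀ {x}, Irr x → hi (st x) = hi x := by
    intro x hx
    refine le_antisymm ((hhi _ _).1 ((hst x hx).2.trans (le_hi x))) ((hhi _ _).1 ?_)
    refine (comparable_of_upper (hst x hx).2 (le_hi _) (st_irr hx)).resolve_right fun h => ?_
    exact (hst x hx).1.lt.not_ge ((le_hi _).trans ((hr _ _).2 ((hlo _ _).1 h)))
  let edge : ∀ x, Irr x → {q : Fin 4 × P // r q.1 ⋖ q.2} := fun x hx =>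
    ⟨(lo x, st x), (hst x hx).1⟩
  have edge_st : ∀ {x y} (hx : Irr x) (hy' : Irr y), x ≤ y → ¬ x ≤ r (lo y) →
      edge x hx = edge y hy' := by
    intro x y hx hy' hxy hn
    have h1 := down_lo hxy hn
    have h2 : st x = st y := by
      have hc := (hst x hx).1
      rw [h1] at hc
      have hd := (hst y hy').1
      rcases comparable_of_lower ((hst x hx).2.trans hxy) (hst y hy').2
        (down_irr ((hst x hx).2.trans hxy) hc.lt.not_ge) with h | h
      · exact (hd.eq_or_eq hc.le h).resolve_left hc.lt.ne'
      · exact ((hc.eq_or_eq hd.le h).resolve_left hd.lt.ne').symm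
    exact Subtype.ext (Prod.ext h1 h2)
  have edge_total : ∀ {x y} (hx : Irr x) (hy' : Irr y), edge x hx = edge y hy' →
      x ≤ y ∨ y ≤ x := by
    intro x y hx hy' h
    have h2 : st x = st y := congrArg (fun q => q.1.2) h
    exact comparable_of_upper (hst x hx).2 (h2 ▸ (hst y hy').2) (st_irr hx)
  -- The position on an edge only has to increase strictly; the size of the lower set does so
  -- without counting along the edge.
  let ht : P → ℕ := fun x => (Set.Iic x).ncard
  have ht_mono : StrictMono ht := fun x y hxy =>
    Set.ncard_lt_ncard (Set.Iic_ssubset_Iic.2 hxy) (Set.toFinite _)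
  have hf : ∀ x, ∃ z : Net F, (∀ k, x = r k → z = .node k) ∧
      ∀ hx : Irr x, z = .pt (edge x hx) (ht x) := by
    intro x
    by_cases hx : Irr x
    · exact ⟨.pt (edge x hx) (ht x), fun k hk => absurd hk (hne hx k), fun _ => rfl⟩
    · obtain ⟨k, rfl⟩ := (hirr x).1 hx
      exact ⟨.node k, fun l hl => by rw [hinj hl], fun h => absurd h hx⟩
  choose f hf1 hf2 using hf
  have hfr : ∀ k, f (r k) = .node k := fun k => hf1 _ k rfl
  have hle : ∀ x y, f x ≤ f y ↔ x ≤ y := by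
    intro x y
    by_cases hx : Irr x <;> by_cases hy' : Irr y
    · rw [hf2 x hx, hf2 y hy', Net.pt_le_pt]
      change _ ∨ hi (st x) ≤ lo y ↔ _
      rw [hi_st hx]
      constructor
      · rintro (⟨h, h'⟩ | h)
        · refine (edge_total hx hy' h).elim id fun hyx => ?_
          rcases hyx.eq_or_lt with hyx | hyx
          · exact hyx.ge
          · exact absurd (ht_mono hyx) h'.not_gt
        · exact (le_hi x).trans (((hr _ _).2 h).trans (lo_le y))
      · intro hxy
        by_cases hn : x ≤ r (lo y)
        · exact Or.inr ((hhi _ _).1 hn)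
        · exact Or.inl ⟨edge_st hx hy' hxy hn, ht_mono.monotone hxy⟩
    · obtain ⟨k, rfl⟩ := (hirr y).1 hy'
      rw [hfr, hf2 x hx, Net.pt_le_node, hhi, ← hi_st hx]
    · obtain ⟨k, rfl⟩ := (hirr x).1 hx
      rw [hfr, hf2 y hy', Net.node_le_pt, hlo]
    · obtain ⟨k, rfl⟩ := (hirr x).1 hx
      obtain ⟨l, rfl⟩ := (hirr y).1 hy'
      rw [hfr, hfr, Net.node_le_node, hr]
  have lo_of_cov : ∀ {k y}, r k ⋖ y → Irr y → lo y = k := by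
    intro k y hky hy'
    have h1 : k ≤ lo y := (hlo _ _).1 hky.le
    exact hinj ((hky.eq_or_eq ((hr _ _).2 h1) (lo_le y)).resolve_right (lo_lt hy').ne)
  have edge_of_cov : ∀ {k y} (hky : r k ⋖ y) (hy' : Irr y), edge y hy' = ⟨(k, y), hky⟩ := by
    intro k y hky hy'
    have h1 := lo_of_cov hky hy'
    have h2 := hst y hy'
    rw [h1] at h2
    refine Subtype.ext (Prod.ext h1 ?_)
    exact (hky.eq_or_eq h2.1.le h2.2).resolve_left h2.1.lt.ne'
  refine ⟨F, ⟨fun k => ?_, fun k => ?_⟩, ⟨⟨OrderEmbedding.ofMapLEIff f hle, r, hfr, ?_⟩⟩⟩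
  · obtain ⟨y, hy', hyk⟩ := exists_covBy_le_of_lt ((hlt k.castSucc k.succ).2 Fin.castSucc_lt_succ)
    refine ⟨⟨(k.castSucc, y), hy'⟩, rfl, ?_⟩
    have h1 := (hhi _ _).1 hyk
    have h2 := (hlt _ _).1 (hy'.lt.trans_le (le_hi y))
    exact le_antisymm h1 (Fin.castSucc_lt_iff_succ_le.1 h2)
  · have hk := (hirr (r k)).2 ⟨k, rfl⟩
    by_cases hu : {z : P | r k ⋖ z}.Subsingleton
    · have hl : ¬ {z : P | z ⋖ r k}.Subsingleton := fun h => hk ⟨h, hu⟩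
      obtain ⟨a, ha, b, hb, hab⟩ := Set.not_subsingleton_iff.1 hl
      right
      have ha' : a ⋖ r k := ha
      have hb' : b ⋖ r k := hb
      have hhik : ∀ {x}, x ⋖ r k → Irr x → hi x = k := by
        intro x hxk hx
        refine hinj ((hxk.eq_or_eq (le_hi x) ((hr _ _).2 ((hhi _ _).1 hxk.le))).resolve_left ?_)
        exact (hne hx _).symm
      have key : ∀ {x}, x ⋖ r k → ∃ q : {q : Fin 4 × P // r q.1 ⋖ q.2}, F.hi q = k ∧
          ((∃ hx : Irr x, q = edge x hx) ∨ (q.1.2 = r k ∧ r q.1.1 = x)) := by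
        intro x hxk
        by_cases hx : Irr x
        · exact ⟨edge x hx, (hi_st hx).trans (hhik hxk hx), Or.inl ⟨hx, rfl⟩⟩
        · obtain ⟨l, rfl⟩ := (hirr x).1 hx
          exact ⟨⟨(l, r k), hxk⟩, hi_r k, Or.inr ⟨rfl, rfl⟩⟩
      obtain ⟨d, hd, hd'⟩ := key ha'
      obtain ⟨e, he, he'⟩ := key hb'
      refine ⟨d, e, ?_, hd, he⟩
      rintro rfl
      rcases hd' with ⟨hx, rfl⟩ | ⟨h1, h2⟩ <;> rcases he' with ⟨hx', h'⟩ | ⟨h1', h2'⟩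
      · rcases edge_total hx hx' h' with h | h
        · exact hab ((ha'.eq_or_eq h hb'.le).resolve_right hb'.lt.ne).symm
        · exact hab ((hb'.eq_or_eq h ha'.le).resolve_right ha'.lt.ne)
      · exact hne (st_irr hx _ le_rfl (hst a hx).2) k h1'
      · subst h'
        exact hne (st_irr hx' _ le_rfl (hst b hx').2) k h1
      · exact hab (h2.symm.trans h2')
    · obtain ⟨a, ha, b, hb, hab⟩ := Set.not_subsingleton_iff.1 hu
      exact Or.inl ⟨⟨(k, a), ha⟩, ⟨(k, b), hb⟩, fun h => hab (congrArg (fun q => q.1.2) h), rfl, rfl⟩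
  -- If `y` is irreducible, it lies on the edge. If `y` is a node, the interval from `r k` to `y` is
  -- a covering, so any edge within it coincides with the given one.
  · rintro ⟨⟨k, y⟩, hky⟩ ⟨⟨⟨l, z⟩, hlz⟩, hd, h1, h2⟩
    have hky' : r k ⋖ y := hky
    have hlz' : r l ⋖ z := hlz
    by_cases hy' : Irr y
    · exact ⟨y, ht y, by rw [OrderEmbedding.coe_ofMapLEIff, hf2 y hy', edge_of_cov hky hy']⟩
    · obtain ⟨m, rfl⟩ := (hirr y).1 hy'
      have h1' : k ≤ l := h1
      have h2' : hi z ≤ m := (hi_r m) ▸ h2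
      have hzm : z ≤ r m := (hhi _ _).2 h2'
      have hlk : l = k := hinj ((hky'.eq_or_eq ((hr _ _).2 h1')
        (hlz'.le.trans hzm)).resolve_right (hlz'.lt.trans_le hzm).ne)
      subst hlk
      have hzm' := (hky'.eq_or_eq hlz'.le hzm).resolve_left hlz'.lt.ne'
      subst hzm'
      exact absurd rfl hd

theorem IsRCBlock.exists_rep {L : Type*} [Lattice L] [Finite L] (h : IsRCBlock L 4 3) :
    ∃ p, (frame p).Good ∧ Nonempty (Rep (frame p) L) := by
  obtain ⟨⟨⟨t, ht, ht'⟩, ⟨b, hb, hb'⟩⟩, hcard, hchain, hnull⟩ := h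
  obtain ⟨g⟩ : Nonempty (Fin 4 ≃o {a : L // Reducible a}) := by
    refine nonempty_orderIso_of_card_eq le_total (fun x y => ?_) ?_
    · rcases eq_or_ne x y with rfl | hxy
      · exact Or.inl le_rfl
      · exact hchain x.2 y.2 (fun h => hxy (Subtype.ext h))
    · rw [Nat.card_eq_fintype_card, Fintype.card_fin, ← hcard]
      rfl
  let r : Fin 4 → L := fun k => g k
  have hr : ∀ k l, r k ≤ r l ↔ k ≤ l := fun k l => g.le_iff_le
  have hrinj : Function.Injective r := fun k l h => g.injective (Subtype.ext h)
  have hirr : ∀ x, ¬ Irr x ↔ ∃ k, x = r k := by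
    intro x
    rw [← reducible_iff]
    refine ⟨fun hx => ⟨g.symm ⟨x, hx⟩, ?_⟩, ?_⟩
    · change x = (g (g.symm ⟨x, hx⟩) : L)
      rw [g.apply_symm_apply]
    · rintro ⟨k, rfl⟩
      exact (g k).2
  have hbot : IsBot (r 0) := by
    obtain ⟨k, rfl⟩ := (hirr b).1 (reducible_iff.1 (Or.inl hb'))
    exact fun x => ((hr _ _).2 (Fin.zero_le k)).trans (hb x)
  have htop : IsTop (r 3) := by
    obtain ⟨k, rfl⟩ := (hirr t).1 (reducible_iff.1 (Or.inr ht'))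
    exact fun x => (ht x).trans ((hr _ _).2 (Fin.le_last k))
  obtain ⟨F, hF, ⟨R⟩⟩ := exists_rep_of_chain hr hirr hbot htop
  -- Nullity three enters here: the number of coverings starting at nodes is `3 + 4 - 1`.
  have hE : Nat.card {q : Fin 4 × L // r q.1 ⋖ q.2} = 6 := by
    rw [nullity_eq hbot hrinj] at hnull
    · push_cast at hnull
      omega
    · intro x hx
      have hx' : Irr x := by
        by_contra hn
        obtain ⟨k, rfl⟩ := (hirr x).1 hn
        exact hx ⟨k, rfl⟩
      have hxt : x < r 3 := lt_of_le_of_ne (htop x) fun h => hx ⟨3, h.symm⟩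
      obtain ⟨z, hz, -⟩ := exists_covBy_le_of_lt hxt
      exact ⟨z, hz, fun y hy => hx'.2 hy hz⟩
  choose ch hch1 hch2 using hF.chain
  have hchinj : Function.Injective ch := fun k l h =>
    Fin.castSucc_injective _ (by rw [← hch1, ← hch1, h])
  obtain ⟨ε, hε⟩ : ∃ ε : Fin 3 ⊕ Fin 3 ≃ {q : Fin 4 × L // r q.1 ⋖ q.2},
      ∀ k, ε (.inl k) = ch k := by
    classical
    have hc : Nat.card {q // q ∉ Set.range ch} = 3 := by
      have h1 := Nat.card_congr (Equiv.sumCompl (· ∈ Set.range ch))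
      rw [Nat.card_sum, hE] at h1
      have h2 := Nat.card_congr (Equiv.ofInjective ch hchinj)
      rw [Nat.card_eq_fintype_card, Fintype.card_fin] at h2
      have h3 : Nat.card {q // q ∈ Set.range ch} = 3 := h2.symm
      omega
    refine ⟨(Equiv.sumCongr (Equiv.ofInjective ch hchinj)
      (Finite.equivFinOfCardEq hc).symm).trans (Equiv.sumCompl (· ∈ Set.range ch)), fun k => rfl⟩
  let p : Fin 3 → {q : Fin 4 × Fin 4 // q.1 < q.2} := fun c =>
    ⟨(F.lo (ε (.inr c)), F.hi (ε (.inr c))), F.lt _⟩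
  have hlo : ∀ e, (frame p).lo e = F.lo (ε e) := by
    rintro (k | c)
    · rw [hε, hch1, frame_lo_inl]
    · rfl
  have hhi : ∀ e, (frame p).hi e = F.hi (ε e) := by
    rintro (k | c)
    · rw [hε, hch2, frame_hi_inl]
    · rfl
  refine ⟨p, ⟨fun k => ⟨.inl k, rfl, rfl⟩, fun k => ?_⟩,
    ⟨R.relabel ε.symm (fun e => by simp [hlo]) (fun e => by simp [hhi])⟩⟩
  refine (hF.branch k).imp ?_ ?_
  · rintro ⟨d, e, hde, hd, he⟩
    exact ⟨ε.symm d, ε.symm e, fun h => hde (ε.symm.injective h), by simp [hlo, hd],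
      by simp [hlo, he]⟩
  · rintro ⟨d, e, hde, hd, he⟩
    exact ⟨ε.symm d, ε.symm e, fun h => hde (ε.symm.injective h), by simp [hhi, hd],
      by simp [hhi, he]⟩

/-! ### Blocks of the three types -/

theorem finite_chainAdjunct (p : Fin 3 → {q : Fin 4 × Fin 4 // q.1 < q.2}) :
    Finite (ChainAdjunct p) := by
  refine Finite.of_surjective (Sum.elim ChainAdjunct.chain ChainAdjunct.pt) ?_
  rintro (k | c)
  · exact ⟨.inl k, rfl⟩
  · exact ⟨.inr c, rfl⟩

/-- The representation of the adjunct of the chain with one-element chains. -/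
def Rep.ofChainAdjunct {p : Fin 3 → {q : Fin 4 × Fin 4 // q.1 < q.2}} (hp : Wide p) :
    Rep (frame p) (ChainAdjunct p) where
  emb := OrderEmbedding.ofMapLEIff
    (fun | .chain k => .node k
         | .pt c => .pt (.inr c) 0) (by
      rintro (k | c) (l | d)
      · rfl
      · rfl
      · rfl
      · change ((Sum.inr c : Fin 3 ⊕ Fin 3) = .inr d ∧ 0 ≤ 0) ∨ _ ↔ c = d ∨ _
        simp only [Sum.inr.injEq, le_refl, and_true]
        rfl)
  nd := .chain
  emb_nd _ := rfl
  exists_pt e he := by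
    rcases e with k | c
    · exact absurd he (frame_not_essential_inl hp k)
    · exact ⟨.pt c, 0, rfl⟩

/-- The lists of pairs differ even up to reordering, and the only symmetry is the exchange of the
two equal pairs in the first two types. -/
theorem basicPairs_perm : ∀ (i i' : Fin 3) (σ : Equiv.Perm (Fin 3)),
    (∀ c, basicPairs i' (σ c) = basicPairs i c) →
      i = i' ∧ (σ = 1 ∨ i ≠ 2 ∧ σ = Equiv.swap 1 2) := by
  decide

theorem basicPairs_swap : ∀ i : Fin 3, i ≠ 2 → ∀ c,
    basicPairs i (Equiv.swap 1 2 c) = basicPairs i c := by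
  decide

theorem eq_of_basicB_orderIso {i i' : Fin 3} (g : BasicB i ≃o BasicB i') : i = i' := by
  have := finite_chainAdjunct (basicPairs i)
  have := finite_chainAdjunct (basicPairs i')
  obtain ⟨-, σ, hσ⟩ := Rep.exists_perm_of_orderIso (R := .ofChainAdjunct (basicPairs_wide i))
    (R' := .ofChainAdjunct (basicPairs_wide i')) (basicPairs_wide i) (basicPairs_wide i')
    (frame_basicPairs_good i) (frame_basicPairs_good i') g
  exact (basicPairs_perm i i' σ fun c => (hσ c).1).1

section Classification

variable {L : Type*} [Lattice L] [Finite L]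

theorem Rep.exists_permute {P : Type*} [PartialOrder P]
    {p p' : Fin 3 → {q : Fin 4 × Fin 4 // q.1 < q.2}} (R : Rep (frame p) P)
    (σ : Equiv.Perm (Fin 3)) (h : ∀ c, p (σ c) = p' c) :
    ∃ R' : Rep (frame p') P, ∀ c, R'.size (.inr c) = R.size (.inr (σ c)) := by
  let ε : Fin 3 ⊕ Fin 3 ≃ Fin 3 ⊕ Fin 3 := Equiv.sumCongr (Equiv.refl _) σ.symm
  have hε : ∀ c, ε (.inr (σ c)) = .inr c := fun c => by simp [ε]
  refine ⟨R.relabel ε ?_ ?_, fun c => ?_⟩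
  · rintro (k | c)
    · rfl
    · obtain ⟨c, rfl⟩ := σ.surjective c
      rw [hε, frame_lo_inr, frame_lo_inr, h]
  · rintro (k | c)
    · rfl
    · obtain ⟨c, rfl⟩ := σ.surjective c
      rw [hε, frame_hi_inr, frame_hi_inr, h]
  · rw [← R.relabel_size ε, hε]

theorem Rep.exists_sorted {P : Type*} [PartialOrder P] {i : Fin 3}
    (R : Rep (frame (basicPairs i)) P) :
    ∃ R' : Rep (frame (basicPairs i)) P, i ≠ 2 → R'.size (.inr 1) ≤ R'.size (.inr 2) := by
  by_cases hi : i = 2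
  · exact ⟨R, fun h => absurd hi h⟩
  rcases le_total (R.size (.inr 1)) (R.size (.inr 2)) with h | h
  · exact ⟨R, fun _ => h⟩
  · obtain ⟨R', hR'⟩ := R.exists_permute (Equiv.swap 1 2) (basicPairs_swap i hi)
    refine ⟨R', fun _ => ?_⟩
    rw [hR', hR', Equiv.swap_apply_left, Equiv.swap_apply_right]
    exact h

/-- Holds for every order of removals, so the existential definition of `HasBasicBlock` determines
the type unambiguously. -/
theorem Rep.nonempty_orderIso_basicB {i : Fin 3} (R : Rep (frame (basicPairs i)) L) {S : Set L}
    (hS : IsBasicBlockOf S) : Nonempty (S ≃o BasicB i) := by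
  obtain ⟨⟨R'⟩, h⟩ := R.of_isBasicBlockOf (frame_basicPairs_good i) hS
  exact R'.nonempty_orderIso_chainAdjunct (basicPairs_wide i) (frame_basicPairs_good i) h

theorem Rep.hasBasicBlock {i : Fin 3} (R : Rep (frame (basicPairs i)) L) :
    HasBasicBlock L (BasicB i) := by
  obtain ⟨S, hS⟩ := R.exists_isBasicBlockOf (frame_basicPairs_good i)
  exact ⟨S, hS, R.nonempty_orderIso_basicB hS⟩

theorem HasBasicBlock.hasBasicBlockHeight {L : Type*} [Lattice L] {i : Fin 3} (h : HasBasicBlock L (BasicB i)) :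
    HasBasicBlockHeight L 3 := by
  obtain ⟨S, hS, ⟨g⟩⟩ := h
  refine ⟨S, hS, ?_⟩
  rw [Order.krullDim_eq_of_orderIso g, krullDim_chainAdjunct (basicPairs_wide i)]
  rfl

/-- A block and its basic block are represented in the same frame, so the height of the latter
constrains the pairs of the former. -/
theorem IsRCBlock.exists_rep_basicPairs (h : IsRCBlock L 4 3) (hh : HasBasicBlockHeight L 3) :
    ∃ i, Nonempty (Rep (frame (basicPairs i)) L) := by
  obtain ⟨p, hF, ⟨R⟩⟩ := h.exists_rep
  obtain ⟨S, hS, hdim⟩ := hh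
  obtain ⟨⟨R'⟩, -⟩ := R.of_isBasicBlockOf hF hS
  obtain ⟨i, σ, hσ⟩ := exists_basicPairs_of_good (R'.wide_of_krullDim hdim) hF
  obtain ⟨R'', -⟩ := R.exists_permute σ hσ
  exact ⟨i, ⟨R''⟩⟩

theorem IsRCBlock.nonempty_rep {i : Fin 3} (h : IsRCBlock L 4 3)
    (hh : HasBasicBlock L (BasicB i)) : Nonempty (Rep (frame (basicPairs i)) L) := by
  obtain ⟨i', ⟨R⟩⟩ := h.exists_rep_basicPairs hh.hasBasicBlockHeight
  obtain ⟨S, hS, ⟨g⟩⟩ := hh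
  obtain ⟨g'⟩ := R.nonempty_orderIso_basicB hS
  obtain rfl := eq_of_basicB_orderIso (g.symm.trans g')
  exact ⟨R⟩

end Classification

/-! ### Parametrization by edge sizes -/

/-- The possible numbers of elements on the edges, for blocks on `j` elements of the given type;
parallel edges are sorted by their numbers of elements. -/
def sizes (j : ℕ) (i : Fin 3) : Set (Fin 3 ⊕ Fin 3 → ℕ) :=
  {s | (∀ c, 0 < s (.inr c)) ∧ j = 4 + ∑ e, s e ∧ (i ≠ 2 → s (.inr 1) ≤ s (.inr 2))}

/-- An isomorphism fixes every edge or exchanges the two parallel ones; sorting their sizes makes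
the size vector an invariant in the second case as well. -/
theorem eq_of_sizes {P Q : Type*} [PartialOrder P] [PartialOrder Q] [Finite P] [Finite Q]
    {i i' : Fin 3} (R : Rep (frame (basicPairs i)) P) (R' : Rep (frame (basicPairs i')) Q)
    {j : ℕ} (hR : R.size ∈ sizes j i) (hR' : R'.size ∈ sizes j i') (g : P ≃o Q) :
    i = i' ∧ R.size = R'.size := by
  obtain ⟨h1, σ, hσ⟩ := Rep.exists_perm_of_orderIso (R := R) (R' := R') (basicPairs_wide i)
    (basicPairs_wide i') (frame_basicPairs_good i) (frame_basicPairs_good i') g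
  obtain ⟨hi, hσ'⟩ := basicPairs_perm i i' σ fun c => (hσ c).1
  refine ⟨hi, ?_⟩
  subst hi
  have h2 : ∀ c, R'.size (.inr (σ c)) = R.size (.inr c) := fun c => (hσ c).2
  ext (k | c)
  · exact h1 k
  · rcases hσ' with rfl | ⟨hi, rfl⟩
    · exact (h2 c).symm
    · have a := hR.2.2 hi
      have b := hR'.2.2 hi
      have c0 := h2 0
      have c1 := h2 1
      have c2 := h2 2
      rw [Equiv.swap_apply_of_ne_of_ne (by decide) (by decide)] at c0
      rw [Equiv.swap_apply_left] at c1
      rw [Equiv.swap_apply_right] at c2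
      fin_cases c
      · exact c0.symm
      · change R.size (.inr 1) = R'.size (.inr 1)
        omega
      · change R.size (.inr 2) = R'.size (.inr 2)
        omega

theorem Rep.size_mem_sizes {P : Type*} [PartialOrder P] [Finite P] {i : Fin 3}
    (R : Rep (frame (basicPairs i)) P) (h : i ≠ 2 → R.size (.inr 1) ≤ R.size (.inr 2)) {j : ℕ}
    (hj : Nat.card P = j) : R.size ∈ sizes j i := by
  refine ⟨fun c => ?_, hj ▸ R.card_eq, h⟩
  obtain ⟨x, hx⟩ := R.exists_pt (.inr c) (frame_essential_inr c)
  have : Nonempty {x // R.On (.inr c) x} := ⟨⟨x, hx⟩⟩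
  exact Nat.card_pos

/-- The isomorphism classes of given type are parametrized by the numbers of elements on the
edges. -/
theorem exists_parametrization (j : ℕ) :
    ∃ f : (i : Fin 3) → sizes j i → LatticeClass j,
      (∀ i, blockClassOfType j 4 3 (BasicB i) = Set.range (f i)) ∧
      blockClass j 4 3 3 = ⋃ i, Set.range (f i) ∧
      ∀ i i' s s', f i s = f i' s' → i = i' ∧ (s : Fin 3 ⊕ Fin 3 → ℕ) = s' := by
  have hex : ∀ (i : Fin 3) (s : sizes j i), ∃ L : Lattice (Fin j),
      ∃ R : @Rep _ (frame (basicPairs i)) (Fin j) L.toPartialOrder,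
        @Rep.size _ _ (Fin j) L.toPartialOrder R = s := by
    rintro i ⟨s, hs⟩
    obtain ⟨L, R, hR⟩ := Rep.exists_lattice (frame (basicPairs i)) s (n := j) (by
      rintro (k | c) he
      · exact absurd he (frame_not_essential_inl (basicPairs_wide i) k)
      · exact hs.1 c) hs.2.1
    exact ⟨L, R, funext hR⟩
  choose M R hR using hex
  have hmem : ∀ i (L : Lattice (Fin j)),
      Nonempty (@Rep _ (frame (basicPairs i)) (Fin j) L.toPartialOrder) →
        classOf L ∈ Set.range fun s => classOf (M i s) := by
    rintro i L ⟨R₀⟩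
    obtain ⟨R₁, h₁⟩ := @Rep.exists_sorted (Fin j) L.toPartialOrder i R₀
    have h₂ := @Rep.size_mem_sizes (Fin j) L.toPartialOrder _ i R₁ h₁ j (by simp)
    refine ⟨⟨_, h₂⟩, Quotient.sound ?_⟩
    exact @Rep.nonempty_orderIso_of_size_eq _ _ (Fin j) (Fin j) (M i ⟨_, h₂⟩).toPartialOrder
      L.toPartialOrder _ _ (R i ⟨_, h₂⟩) R₁ fun e => congrFun (hR i ⟨_, h₂⟩) e
  have hblock : ∀ i s, @IsRCBlock (Fin j) (M i s) 4 3 := fun i s =>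
    @Rep.isRCBlock _ (Fin j) (M i s) _ (R i s) (frame_basicPairs_good i)
  have hbasic : ∀ i s, @HasBasicBlock (Fin j) (M i s) (BasicB i) _ := fun i s =>
    @Rep.hasBasicBlock (Fin j) (M i s) _ i (R i s)
  refine ⟨fun i s => classOf (M i s), fun i => ?_, ?_, ?_⟩
  · apply Set.Subset.antisymm
    · rintro _ ⟨L, ⟨h1, h2⟩, rfl⟩
      exact hmem i L (@IsRCBlock.nonempty_rep (Fin j) L _ i h1 h2)
    · rintro _ ⟨s, rfl⟩
      exact ⟨M i s, ⟨hblock i s, hbasic i s⟩, rfl⟩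
  · apply Set.Subset.antisymm
    · rintro _ ⟨L, ⟨h1, h2⟩, rfl⟩
      obtain ⟨i, hi⟩ := @IsRCBlock.exists_rep_basicPairs (Fin j) L _ h1 h2
      exact Set.mem_iUnion.2 ⟨i, hmem i L hi⟩
    · rintro _ h
      obtain ⟨i, s, rfl⟩ := Set.mem_iUnion.1 h
      exact ⟨M i s, ⟨hblock i s, @HasBasicBlock.hasBasicBlockHeight (Fin j) (M i s) i
        (hbasic i s)⟩, rfl⟩
  · intro i i' s s' h
    obtain ⟨g⟩ : Nonempty (@OrderIso (Fin j) (Fin j) (M i s).toLE (M i' s').toLE) :=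
      Quotient.exact h
    have := @eq_of_sizes (Fin j) (Fin j) (M i s).toPartialOrder (M i' s').toPartialOrder _ _ i i'
      (R i s) (R i' s') j (by rw [hR]; exact s.2) (by rw [hR]; exact s'.2) g
    rwa [hR, hR] at this

theorem finite_sizes (j : ℕ) (i : Fin 3) : (sizes j i).Finite := by
  refine (Set.finite_Iic (fun _ => j)).subset fun s hs e => ?_
  have := Finset.single_le_sum (f := s) (fun _ _ => Nat.zero_le _) (Finset.mem_univ e)
  have := hs.2.1
  change s e ≤ j
  omega

theorem ncard_blockClassOfType (j : ℕ) (i : Fin 3) :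
    (blockClassOfType j 4 3 (BasicB i)).ncard = (sizes j i).ncard := by
  obtain ⟨f, h1, -, h3⟩ := exists_parametrization j
  rw [h1, ← Nat.card_coe_set_eq, Nat.card_range_of_injective, Nat.card_coe_set_eq]
  exact fun s s' h => Subtype.ext (h3 i i s s' h).2

theorem ncard_blockClass (j : ℕ) :
    (blockClass j 4 3 3).ncard = ∑ i, (blockClassOfType j 4 3 (BasicB i)).ncard := by
  obtain ⟨f, h1, h2, h3⟩ := exists_parametrization j
  have := fun i => (finite_sizes j i).to_subtype
  rw [h2, Set.ncard_iUnion_of_finite]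
  · rw [finsum_eq_sum_of_fintype]
    simp_rw [h1]
  · exact fun i => Set.finite_range (f i)
  · intro i i' hii'
    refine Set.disjoint_left.2 ?_
    rintro _ ⟨s, rfl⟩ ⟨s', h⟩
    exact hii' (h3 i' i s' s h).1.symm

/-! ### Counting size vectors -/

/-- A partition into two parts is determined by its smaller part, which ranges over `1, ..., n / 2`.
-/
theorem partitionCount_two (n : ℕ) : partitionCount n 2 = n / 2 := by
  have h : (Finset.Icc 1 (n / 2)).card = n / 2 := by simp
  rw [partitionCount, ← h, eq_comm]
  refine Finset.card_bij (fun a ha => ⟨{a, n - a}, ?_, ?_⟩) ?_ ?_ ?_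
  · intro i hi
    have := Finset.mem_Icc.1 ha
    simp only [Multiset.insert_eq_cons, Multiset.mem_cons, Multiset.mem_singleton] at hi
    omega
  · have := Finset.mem_Icc.1 ha
    simp only [Multiset.insert_eq_cons, Multiset.sum_cons, Multiset.sum_singleton]
    omega
  · intro a ha
    simp
  · intro a ha b hb hab
    have h1 := Finset.mem_Icc.1 ha
    have h2 := Finset.mem_Icc.1 hb
    have h3 : ({a, n - a} : Multiset ℕ) = {b, n - b} := congrArg Nat.Partition.parts hab
    have h4 : a ∈ ({b, n - b} : Multiset ℕ) := h3 ▸ by simp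
    simp only [Multiset.insert_eq_cons, Multiset.mem_cons, Multiset.mem_singleton] at h4
    omega
  · intro q hq
    obtain ⟨a, b, hab⟩ := Multiset.card_eq_two.1 (Finset.mem_filter.1 hq).2
    have hsum := q.parts_sum
    have ha := q.parts_pos (i := a) (by simp [hab])
    have hb := q.parts_pos (i := b) (by simp [hab])
    rw [hab] at hsum
    simp only [Multiset.insert_eq_cons, Multiset.sum_cons, Multiset.sum_singleton] at hsum
    rcases le_total a b with h | h
    · refine ⟨a, Finset.mem_Icc.2 (by omega), Nat.Partition.ext ?_⟩
      change ({a, n - a} : Multiset ℕ) = _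
      rw [hab, show n - a = b by omega]
    · refine ⟨b, Finset.mem_Icc.2 (by omega), Nat.Partition.ext ?_⟩
      change ({b, n - b} : Multiset ℕ) = _
      rw [hab, show n - b = a by omega, Multiset.pair_comm]

/-- Two chain edges carry `s - 1` and `r - 1` elements and the parallel edges together `l`. The
remaining `j - s - r - l - 2` elements are split between the third chain edge (possibly none) and
the single extra edge (at least one), in that many ways. -/
theorem ncard_sizes_of_ne {j : ℕ} {i : Fin 3} (hi : i ≠ 2) :
    (sizes j i).ncard = ∑ s ∈ Finset.Icc 1 (j - 6), ∑ r ∈ Finset.Icc 1 (j - s - 5),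
      ∑ l ∈ Finset.Icc 2 (j - s - r - 3), (j - s - r - l - 2) * partitionCount l 2 := by
  let T := (Finset.Icc 1 (j - 6)).sigma fun s => (Finset.Icc 1 (j - s - 5)).sigma fun r =>
    (Finset.Icc 2 (j - s - r - 3)).sigma fun l =>
      Finset.range (j - s - r - l - 2) ×ˢ Finset.Icc 1 (l / 2)
  let g : (Σ _ : ℕ, Σ _ : ℕ, Σ _ : ℕ, ℕ × ℕ) → Fin 3 ⊕ Fin 3 → ℕ := fun ⟨s, r, l, t, a⟩ =>
    Sum.elim ![s - 1, r - 1, t] ![j - s - r - l - 2 - t, a, l - a]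
  have hcard : T.card = ∑ s ∈ Finset.Icc 1 (j - 6), ∑ r ∈ Finset.Icc 1 (j - s - 5),
      ∑ l ∈ Finset.Icc 2 (j - s - r - 3), (j - s - r - l - 2) * partitionCount l 2 := by
    simp [T, Finset.card_sigma, partitionCount_two]
  have hT : ∀ s r l t a, (⟨s, r, l, t, a⟩ : Σ _ : ℕ, Σ _ : ℕ, Σ _ : ℕ, ℕ × ℕ) ∈ T ↔
      (1 ≤ s ∧ s ≤ j - 6) ∧ (1 ≤ r ∧ r ≤ j - s - 5) ∧ (2 ≤ l ∧ l ≤ j - s - r - 3) ∧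
        t < j - s - r - l - 2 ∧ 1 ≤ a ∧ a ≤ l / 2 := by
    intro s r l t a
    simp [T]
  have himage : sizes j i = g '' T := by
    apply Set.Subset.antisymm
    · rintro f ⟨h1, h2, h3⟩
      have h3 := h3 hi
      have p0 := h1 0
      have p1 := h1 1
      have p2 := h1 2
      simp only [Fintype.sum_sum_type, Fin.sum_univ_three] at h2
      refine ⟨⟨f (.inl 0) + 1, f (.inl 1) + 1, f (.inr 1) + f (.inr 2), f (.inl 2),
        f (.inr 1)⟩, ?_, ?_⟩
      · rw [Finset.mem_coe, hT]
        omega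
      · funext e
        rcases e with k | c
        · fin_cases k
          · rfl
          · rfl
          · rfl
        · fin_cases c
          · change j - (f (.inl 0) + 1) - (f (.inl 1) + 1) - (f (.inr 1) + f (.inr 2)) - 2 -
              f (.inl 2) = f (.inr 0)
            omega
          · rfl
          · change f (.inr 1) + f (.inr 2) - f (.inr 1) = f (.inr 2)
            omega
    · rintro _ ⟨⟨s, r, l, t, a⟩, h, rfl⟩
      rw [Finset.mem_coe, hT] at h
      refine ⟨fun c => ?_, ?_, fun _ => ?_⟩
      · fin_cases c
        · change 0 < j - s - r - l - 2 - t
          omega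
        · change 0 < a
          omega
        · change 0 < l - a
          omega
      · rw [Fintype.sum_sum_type, Fin.sum_univ_three, Fin.sum_univ_three]
        change j = 4 + ((s - 1 + (r - 1) + t) + (j - s - r - l - 2 - t + a + (l - a)))
        omega
      · change a ≤ l - a
        omega
  have hinj : Set.InjOn g T := by
    rintro ⟨s, r, l, t, a⟩ h ⟨s', r', l', t', a'⟩ h' heq
    rw [Finset.mem_coe, hT] at h h'
    have e0 : s - 1 = s' - 1 := congrFun heq (.inl 0)
    have e1 : r - 1 = r' - 1 := congrFun heq (.inl 1)
    have e2 : t = t' := congrFun heq (.inl 2)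
    have e3 : a = a' := congrFun heq (.inr 1)
    have e4 : l - a = l' - a' := congrFun heq (.inr 2)
    obtain rfl : s = s' := by omega
    obtain rfl : r = r' := by omega
    obtain rfl : l = l' := by omega
    subst e2 e3
    rfl
  rw [himage, hinj.ncard_image, Set.ncard_coe_finset, hcard]

/-- Both sides equal `(j - 2).choose 5`: the sum by the hockey-stick identity, the size vectors by
stars and bars for `j - 7` elements on six edges, after one element is taken from each extra edge.
-/
theorem ncard_sizes_two {j : ℕ} (hj : 7 ≤ j) :
    (sizes j 2).ncard = ∑ p ∈ Finset.Icc 1 (j - 6), (j - p - 2).choose 4 := by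
  have hsum : ∑ p ∈ Finset.Icc 1 (j - 6), (j - p - 2).choose 4 = (j - 2).choose 5 := by
    have := Nat.sum_Icc_choose (j - 3) 4
    rw [show j - 3 + 1 = j - 2 by omega] at this
    rw [← this]
    refine Finset.sum_nbij' (fun p => j - p - 2) (fun m => j - m - 2) ?_ ?_ ?_ ?_ ?_ <;>
      intro a ha <;> simp only [Finset.mem_Icc] at ha ⊢ <;> omega
  have hcard := Finset.card_finsuppAntidiag_nat_eq_choose
    (s := (Finset.univ : Finset (Fin 3 ⊕ Fin 3))) (j - 7)
  rw [Finset.card_univ, Fintype.card_sum, Fintype.card_fin,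
    show 3 + 3 + (j - 7) - 1 = j - 2 by omega,
    ← Nat.choose_symm (by omega), show j - 2 - (j - 7) = 5 by omega] at hcard
  rw [hsum, ← hcard, ← Set.ncard_coe_finset]
  let g : (Fin 3 ⊕ Fin 3 →₀ ℕ) → Fin 3 ⊕ Fin 3 → ℕ := fun f =>
    Sum.elim (fun k => f (.inl k)) (fun c => f (.inr c) + 1)
  have hg : Function.Injective g := by
    intro f f' h
    ext (k | c)
    · exact congrFun h (.inl k)
    · exact Nat.succ_injective (congrFun h (.inr c))
  have himage : sizes j 2 = g '' (Finset.univ.finsuppAntidiag (j - 7) :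
      Finset (Fin 3 ⊕ Fin 3 →₀ ℕ)) := by
    apply Set.Subset.antisymm
    · rintro f ⟨h1, h2, -⟩
      have p0 := h1 0
      have p1 := h1 1
      have p2 := h1 2
      refine ⟨Finsupp.equivFunOnFinite.symm
        (Sum.elim (fun k => f (.inl k)) (fun c => f (.inr c) - 1)), ?_, ?_⟩
      · rw [Finset.mem_coe, Finset.mem_finsuppAntidiag]
        refine ⟨?_, Finset.subset_univ _⟩
        simp only [Fintype.sum_sum_type, Fin.sum_univ_three] at h2
        simp only [Finsupp.equivFunOnFinite_symm_apply_apply, Fintype.sum_sum_type,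
          Fin.sum_univ_three, Sum.elim_inl, Sum.elim_inr]
        omega
      · funext e
        rcases e with k | c
        · rfl
        · exact Nat.succ_pred_eq_of_pos (h1 c)
    · rintro _ ⟨f, hf, rfl⟩
      rw [Finset.mem_coe, Finset.mem_finsuppAntidiag] at hf
      refine ⟨fun c => Nat.succ_pos _, ?_, fun h => absurd rfl h⟩
      have h := hf.1
      simp only [Fintype.sum_sum_type, Fin.sum_univ_three] at h
      simp only [g, Fintype.sum_sum_type, Fin.sum_univ_three, Sum.elim_inl, Sum.elim_inr]
      omega
  rw [himage, Set.ncard_image_of_injective _ hg]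

end RCLattice

theorem mainTheorem3 (j : ℕ) (hj : 7 ≤ j) :
    (RCLattice.blockClass j 4 3 3).ncard
        = ∑ i : Fin 3, (RCLattice.blockClassOfType j 4 3 (RCLattice.BasicB i)).ncard ∧
      ∑ i : Fin 3, (RCLattice.blockClassOfType j 4 3 (RCLattice.BasicB i)).ncard
        = (∑ s ∈ Finset.Icc 1 (j - 6), ∑ r ∈ Finset.Icc 1 (j - s - 5),
            ∑ l ∈ Finset.Icc 2 (j - s - r - 3),
              2 * (j - s - r - l - 2) * RCLattice.partitionCount l 2)
          + ∑ p ∈ Finset.Icc 1 (j - 6), (j - p - 2).choose 4 := by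
  refine ⟨RCLattice.ncard_blockClass j, ?_⟩
  simp_rw [RCLattice.ncard_blockClassOfType, Fin.sum_univ_three]
  -- The two dual types contribute the same triple sum, hence the factor 2.
  rw [RCLattice.ncard_sizes_of_ne (by decide), RCLattice.ncard_sizes_of_ne (by decide),
    RCLattice.ncard_sizes_two hj, ← two_mul]
  simp_rw [Finset.mul_sum, mul_assoc]
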